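/- **Best of three worlds.** Online linear optimization: let $d\ge 1$, $T\ge 2$, let $\mathcal K\subset\mathbb R^d$ be compact and convex with $0\in\mathcal K$ and $\|w\|\le D$ for all $w\in\mathcal K$ ($\|\cdot\|$ is the Euclidean norm; $D$ is a known upper bound, taken with $D\ge\frac1{dT}$). In round $t=1,\dots,T$ the learner receives a prediction $m_t\in\mathbb R^d$, plays $w_t\in\mathcal K$, and then receives $\ell_t\in\mathbb R^d$; the loss and prediction vectors are arbitrary with $\|\ell_t-m_t\|\le 1$. Write $\mathrm{Reg}(u)=\sum_{t=1}^T\langle w_t-u,\ell_t\rangle$, $\mathcal L_T=\sum_{t=1}^T(\ell_t-m_t)(\ell_t-m_t)^\top$, $r=\mathrm{rank}\,\mathcal L_T$, $\|w\|_A^2=w^\top A w$, $[n]=\{1,\dots,n\}$, and $D_\psi(u,w)=\psi(u)-\psi(w)-\langle\nabla\psi(w),u-w\rangle$. *Master (MsMwC-Master).* Given finitely many experts $(\eta_k,\mathcal A_k)$, $k\in\mathcal E$, let $w_t^k$ be the decision of the online algorithm $\mathcal A_k$ in round $t$, $\psi(p)=\sum_k\frac1{\eta_k}p_k\ln p_k$,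 $\Lambda_t=\Delta_{\mathcal E}$ (the probability simplex over $\mathcal E$), and $p'_{1,k}\propto\eta_k^2$. In round $t$ the master computes $p_t=\arg\min_{p\in\Lambda_t}\langle p,h_t\rangle+D_\psi(p,p'_t)$ with $h_{t,k}=\langle w_t^k,m_t\rangle$, plays $w_t=\sum_k p_{t,k}w_t^k$, and updates $p'_{t+1}=\arg\min_{p\in\Lambda_t}\langle p,g_t+b_t\rangle+D_\psi(p,p'_t)$ with $g_{t,k}=\langle w_t^k,\ell_t\rangle$ and $b_{t,k}=32\eta_k(g_{t,k}-h_{t,k})^2$. *Base algorithms, with decision set $\Omega$.* - ONS($\eta$): $w'_1=0$, $w_t=\arg\min_{w\in\Omega}\langle w,m_t\rangle+D_{\psi_t}(w,w'_t)$, $w'_{t+1}=\arg\min_{w\in\Omega}\langle w,\nabla_t\rangle+D_{\psi_t}(w,w'_t)$, where $\nabla_t=\ell_t+32\eta\langle w_t,\ell_t-m_t\rangle(\ell_t-m_t)$, $\psi_t(w)=\frac12\|w\|_{A_t}^2$, $A_t=\eta\big(8I+\sum_{s<t}(\nabla_s-m_s)(\nabla_s-m_s)^\top\big)$. - OptGD($\eta$):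 $w'_1=0$, $w_t=\arg\min_{w\in\Omega}\langle w,m_t\rangle+\frac1{2\eta}\|w-w'_t\|^2$, $w'_{t+1}=\arg\min_{w\in\Omega}\langle w,\ell_t\rangle+\frac1{2\eta}\|w-w'_t\|^2$. - AdaGrad($\eta,\eta'$): $w_t=\arg\min_{w\in\Omega}\langle w,\sum_{s<t}\nabla_s+m_t\rangle+\frac1{2\eta}\|w\|^2_{(I+\mathcal G_{t-1})^{1/2}}$, where $\nabla_t=\ell_t+32\eta'\langle w_t,\ell_t-m_t\rangle(\ell_t-m_t)$ and $\mathcal G_t=\sum_{s\le t}(\nabla_s-m_s)(\nabla_s-m_s)^\top$. *Expert sets.* Put $\mathcal K_j=\mathcal K\cap\{w:\|w\|\le 2^j\}$. - $\mathcal E_{\rm ONS}$: for $(d_k,s_k)\in\{-\lceil\log_2(dT)\rceil,\dots,\lceil\log_2D\rceil\}\times[\lceil\log_2T\rceil]$, $\eta_k=\frac1{64\cdot2^{d_k+s_k}}$, and $\mathcal A_k$ is ONS($3\eta_k$) on $\mathcal K_{d_k}$. - $\mathcal E_{\rm GD}$: for $(d_k,s_k)\in\{-\lceil\log_2T\rceil,\dots,\lceil\log_2D\rceil\}\times[\lceil\log_2T\rceil]$,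 $\eta_k=\frac1{32\cdot2^{d_k+s_k}}$, and $\mathcal A_k$ is OptGD($4^{d_k}\eta_k$) on $\mathcal K_{d_k}$. - $\mathcal E_{\rm AG}$: for $(d_k,t_k,l_k)\in\{-\lceil\log_2T\rceil,\dots,\lceil\log_2D\rceil\}\times[\lceil\log_2(dT)\rceil]\times\{-\lceil\log_2T\rceil,\dots,\lceil\log_2(2D^2T)\rceil\}$, $\eta_k=\frac1{64\cdot2^{d_k+t_k}}$, and $\mathcal A_k$ is AdaGrad($2^{l_k+1}\eta_k,\,2\eta_k$) on $\mathcal K_{d_k}$. **Statement.** There is an absolute constant $C>0$ such that, for all data as above, MsMwC-Master run with the union $\mathcal E=\mathcal E_{\rm ONS}\cup\mathcal E_{\rm GD}\cup\mathcal E_{\rm AG}$ plays $w_t\in\mathcal K$ in every round $t\le T$ and, with $L=\ln(dT(1+D))$, satisfies simultaneously for all $u\in\mathcal K$ $$\mathrm{Reg}(u)\le C\,L\Big(1+\max\{r,1\}\,\|u\|+\sqrt{r\sum_{t=1}^T\langle u,\ell_t-m_t\rangle^2}\Big),$$ $$\mathrm{Reg}(u)\le C\,L\Big(1+\|u\|+\|u\|\sqrt{\sum_{t=1}^T\|\ell_t-m_t\|^2}\Big),$$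 $$\mathrm{Reg}(u)\le C\,L\Big(1+\|u\|+\sqrt{\big(u^\top(I+\mathcal L_T)^{1/2}u\big)\,\mathrm{tr}\big(\mathcal L_T^{1/2}\big)}\Big).$$ -/

import Mathlib

noncomputable section

namespace BestOfThree

/-- `ℝ^d` with the Euclidean norm and inner product. -/
abbrev Vec (d : ℕ) := EuclideanSpace ℝ (Fin d)

/-- A minimizer of `f` over `Ω` (arbitrary if there is none). -/
def argminOn {α : Type*} [Nonempty α] (f : α → ℝ) (Ω : Set α) : α :=
  Classical.epsilon fun w => w ∈ Ω ∧ IsMinOn f Ω w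

theorem argminOn_spec {α : Type*} [Nonempty α] {f : α → ℝ} {Ω : Set α}
    (h : ∃ w ∈ Ω, IsMinOn f Ω w) : argminOn f Ω ∈ Ω ∧ IsMinOn f Ω (argminOn f Ω) :=
  Classical.epsilon_spec h

/-- The Bregman divergence `D_ψ(u, w) = ψ(u) - ψ(w) - ⟨∇ψ(w), u - w⟩`. -/
def bregman {V : Type*} [NormedAddCommGroup V] [NormedSpace ℝ V] (ψ : V → ℝ) (u w : V) : ℝ :=
  ψ u - ψ w - fderiv ℝ ψ w (u - w)

/-- The rank-one matrix `x xᵀ`. -/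
def outer {d : ℕ} (x : Vec d) : Matrix (Fin d) (Fin d) ℝ :=
  Matrix.vecMulVec x.ofLp x.ofLp

/-- The quadratic form `wᵀ A w = ‖w‖_A²`. -/
def quadForm {d : ℕ} (A : Matrix (Fin d) (Fin d) ℝ) (w : Vec d) : ℝ :=
  w.ofLp ⬝ᵥ (A.mulVec w.ofLp)

open scoped MatrixOrder in
/-- The positive semidefinite square root of a positive semidefinite matrix. -/
def matSqrt {d : ℕ} (A : Matrix (Fin d) (Fin d) ℝ) : Matrix (Fin d) (Fin d) ℝ :=
  CFC.sqrt A

/-- A deterministic online algorithm: it turns the sequence of loss vectors `ℓ` and the sequence of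
predictions `m` into a sequence of decisions. Rounds are numbered `0, 1, 2, …`. All the algorithms
below are defined by recursion on the round, and the decision of round `t` is computed from
`ℓ s` for `s < t` and `m s` for `s ≤ t` only. -/
abbrev OnlineAlg (d : ℕ) := (ℕ → Vec d) → (ℕ → Vec d) → ℕ → Vec d

/-- `∇c(w)` for the auxiliary cost `c(w) = ⟨w, ℓ⟩ + 16 η ⟨w, ℓ - m⟩²`. -/
def costGrad {d : ℕ} (η : ℝ) (ℓ m w : Vec d) : Vec d :=
  ℓ + (32 * η * inner ℝ w (ℓ - m)) • (ℓ - m)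

/-! ### The variant of Online Newton Step -/

/-- The state at the start of a round: the point `w'_t` and `∑_{s<t} (∇_s - m_s)(∇_s - m_s)ᵀ`. -/
structure OnsState (d : ℕ) where
  center : Vec d
  gram : Matrix (Fin d) (Fin d) ℝ

/-- The regularizer `ψ_t(w) = ‖w‖²_{A_t} / 2` with
`A_t = η (4 I + ∑_{s<t} (∇_s - m_s)(∇_s - m_s)ᵀ + 4 I)`. -/
def onsReg {d : ℕ} (η : ℝ) (st : OnsState d) (w : Vec d) : ℝ :=
  quadForm (η • ((4 : ℝ) • (1 : Matrix (Fin d) (Fin d) ℝ) + st.gram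
    + (4 : ℝ) • (1 : Matrix (Fin d) (Fin d) ℝ))) w / 2

/-- One mirror descent step `argmin_{w ∈ Ω} ⟨w, x⟩ + D_{ψ_t}(w, w'_t)`. -/
def onsStep {d : ℕ} (Ω : Set (Vec d)) (η : ℝ) (st : OnsState d) (x : Vec d) : Vec d :=
  argminOn (fun w => inner ℝ w x + bregman (onsReg η st) w st.center) Ω

def onsState {d : ℕ} (Ω : Set (Vec d)) (η : ℝ) (ℓ m : ℕ → Vec d) : ℕ → OnsState d
  | 0 => ⟨0, 0⟩
  | t + 1 =>
    let st := onsState Ω η ℓ m t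
    let w := onsStep Ω η st (m t)
    let g := costGrad η (ℓ t) (m t) w
    ⟨onsStep Ω η st g, st.gram + outer (g - m t)⟩

/-- Online Newton Step with decision set `Ω` and learning rate `η`. -/
def ons {d : ℕ} (Ω : Set (Vec d)) (η : ℝ) : OnlineAlg d := fun ℓ m t =>
  onsStep Ω η (onsState Ω η ℓ m t) (m t)

/-! ### Optimistic gradient descent -/

/-- One step `argmin_{w ∈ Ω} ⟨w, x⟩ + D_ψ(w, w')` with `ψ(w) = ‖w‖² / (2η)`. -/
def gdStep {d : ℕ} (Ω : Set (Vec d)) (η : ℝ) (w' x : Vec d) : Vec d :=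
  argminOn (fun w => inner ℝ w x + bregman (fun v : Vec d => ‖v‖ ^ 2 / (2 * η)) w w') Ω

def gdCenter {d : ℕ} (Ω : Set (Vec d)) (η : ℝ) (ℓ : ℕ → Vec d) : ℕ → Vec d
  | 0 => 0
  | t + 1 => gdStep Ω η (gdCenter Ω η ℓ t) (ℓ t)

/-- Optimistic gradient descent with decision set `Ω` and learning rate `η`. -/
def optGD {d : ℕ} (Ω : Set (Vec d)) (η : ℝ) : OnlineAlg d := fun ℓ m t =>
  gdStep Ω η (gdCenter Ω η ℓ t) (m t)

/-! ### Optimistic AdaGrad -/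

/-- The state at the start of a round: `∑_{s<t} ∇_s` and
`𝒢_{t-1} = ∑_{s<t} (∇_s - m_s)(∇_s - m_s)ᵀ`. -/
structure AgState (d : ℕ) where
  gradSum : Vec d
  gram : Matrix (Fin d) (Fin d) ℝ

/-- The decision `argmin_{w ∈ Ω} ⟨w, ∑_{s<t} ∇_s + m_t⟩ + ψ_{t-1}(w)`, where
`ψ_{t-1}(w) = ‖w‖²_A / 2` with `A = (I + 𝒢_{t-1})^{1/2} / η`. -/
def agStep {d : ℕ} (Ω : Set (Vec d)) (η : ℝ) (st : AgState d) (mt : Vec d) : Vec d :=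
  argminOn (fun w => inner ℝ w (st.gradSum + mt)
    + quadForm ((1 / η) • matSqrt (1 + st.gram)) w / 2) Ω

def agState {d : ℕ} (Ω : Set (Vec d)) (η η' : ℝ) (ℓ m : ℕ → Vec d) : ℕ → AgState d
  | 0 => ⟨0, 0⟩
  | t + 1 =>
    let st := agState Ω η η' ℓ m t
    let g := costGrad η' (ℓ t) (m t) (agStep Ω η st (m t))
    ⟨st.gradSum + g, st.gram + outer (g - m t)⟩

/-- Optimistic AdaGrad with decision set `Ω` and learning rates `η`, `η'`. -/
def adaGrad {d : ℕ} (Ω : Set (Vec d)) (η η' : ℝ) : OnlineAlg d := fun ℓ m t =>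
  agStep Ω η (agState Ω η η' ℓ m t) (m t)

/-! ### The master algorithm MsMwC-Master -/

/-- An expert `(η_k, 𝒜_k)`: a learning rate and a base algorithm. -/
structure Expert (d : ℕ) where
  rate : ℝ
  alg : OnlineAlg d

section Master

variable {d : ℕ} {ι : Type*} [Fintype ι]

/-- The weighted negative entropy `ψ(p) = ∑_k p_k ln p_k / η_k`. -/
def entropyReg (E : ι → Expert d) (p : ι → ℝ) : ℝ :=
  ∑ k, (1 / (E k).rate) * (p k * Real.log (p k))

/-- One step `argmin_{p ∈ Λ} ⟨p, x⟩ + D_ψ(p, p')`. -/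
def masterStep (E : ι → Expert d) (Λ : Set (ι → ℝ)) (p' x : ι → ℝ) : ι → ℝ :=
  argminOn (fun p => ∑ k, p k * x k + bregman (entropyReg E) p p') Λ

/-- `h_{t,k} = ⟨w_t^k, m_t⟩`, where `w_t^k` is the decision of the `k`-th base algorithm. -/
def predLoss (E : ι → Expert d) (ℓ m : ℕ → Vec d) (t : ℕ) (k : ι) : ℝ :=
  inner ℝ ((E k).alg ℓ m t) (m t)

/-- `g_{t,k} = ⟨w_t^k, ℓ_t⟩`. -/
def expertLoss (E : ι → Expert d) (ℓ m : ℕ → Vec d) (t : ℕ) (k : ι) : ℝ :=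
  inner ℝ ((E k).alg ℓ m t) (ℓ t)

/-- The correction `b_{t,k} = 32 η_k (g_{t,k} - h_{t,k})²`. -/
def correction (E : ι → Expert d) (ℓ m : ℕ → Vec d) (t : ℕ) (k : ι) : ℝ :=
  32 * (E k).rate * (expertLoss E ℓ m t k - predLoss E ℓ m t k) ^ 2

/-- The points `p'_t`, starting from the prior `p'_{1,k} ∝ η_k²`. -/
def masterCenter (E : ι → Expert d) (Λ : ℕ → Set (ι → ℝ)) (ℓ m : ℕ → Vec d) : ℕ → ι → ℝ
  | 0 => fun k => (E k).rate ^ 2 / ∑ j, (E j).rate ^ 2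
  | t + 1 => masterStep E (Λ t) (masterCenter E Λ ℓ m t)
      (fun k => expertLoss E ℓ m t k + correction E ℓ m t k)

/-- The distribution `p_t` over the experts that the master uses in round `t`. -/
def masterWeights (E : ι → Expert d) (Λ : ℕ → Set (ι → ℝ)) (ℓ m : ℕ → Vec d) (t : ℕ) : ι → ℝ :=
  masterStep E (Λ t) (masterCenter E Λ ℓ m t) (predLoss E ℓ m t)

/-- MsMwC-Master with experts `E` and feasible sets `Λ t`: it plays `w_t = ∑_k p_{t,k} w_t^k`. -/
def master (E : ι → Expert d) (Λ : ℕ → Set (ι → ℝ)) : OnlineAlg d := fun ℓ m t =>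
  ∑ k, masterWeights E Λ ℓ m t k • (E k).alg ℓ m t

end Master

/-! ### The three expert sets and their union -/

/-- `⌈log₂ x⌉`. -/
def clog2 (x : ℝ) : ℤ := ⌈Real.logb 2 x⌉

/-- `K ∩ {w : ‖w‖ ≤ 2^j}`. -/
def cut {d : ℕ} (K : Set (Vec d)) (j : ℤ) : Set (Vec d) := K ∩ {w | ‖w‖ ≤ (2 : ℝ) ^ j}

/-- Pairs `(d_k, s_k)`. -/
def onsIndex (d T : ℕ) (D : ℝ) : Finset (ℤ × ℤ) :=
  Finset.Icc (-clog2 ((d : ℝ) * T)) (clog2 D) ×ˢ Finset.Icc 1 (clog2 T)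

def onsRate (k : ℤ × ℤ) : ℝ := 1 / (64 * (2 : ℝ) ^ (k.1 + k.2))

def onsExpert {d : ℕ} (K : Set (Vec d)) (k : ℤ × ℤ) : Expert d :=
  ⟨onsRate k, ons (cut K k.1) (3 * onsRate k)⟩

/-- Pairs `(d_k, s_k)`. -/
def gdIndex (T : ℕ) (D : ℝ) : Finset (ℤ × ℤ) :=
  Finset.Icc (-clog2 T) (clog2 D) ×ˢ Finset.Icc 1 (clog2 T)

def gdRate (k : ℤ × ℤ) : ℝ := 1 / (32 * (2 : ℝ) ^ (k.1 + k.2))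

def gdExpert {d : ℕ} (K : Set (Vec d)) (k : ℤ × ℤ) : Expert d :=
  ⟨gdRate k, optGD (cut K k.1) ((4 : ℝ) ^ k.1 * gdRate k)⟩

/-- Triples `(d_k, t_k, l_k)`. -/
def agIndex (d T : ℕ) (D : ℝ) : Finset (ℤ × ℤ × ℤ) :=
  Finset.Icc (-clog2 T) (clog2 D) ×ˢ Finset.Icc 1 (clog2 ((d : ℝ) * T)) ×ˢ
    Finset.Icc (-clog2 T) (clog2 (2 * D ^ 2 * T))

def agRate (k : ℤ × ℤ × ℤ) : ℝ := 1 / (64 * (2 : ℝ) ^ (k.1 + k.2.1))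

def agExpert {d : ℕ} (K : Set (Vec d)) (k : ℤ × ℤ × ℤ) : Expert d :=
  ⟨agRate k, adaGrad (cut K k.1) ((2 : ℝ) ^ (k.2.2 + 1) * agRate k) (2 * agRate k)⟩

/-- The index set of the union of the three expert sets. -/
abbrev UnionIndex (d T : ℕ) (D : ℝ) : Type :=
  onsIndex d T D ⊕ gdIndex T D ⊕ agIndex d T D

def unionExpert {d : ℕ} (K : Set (Vec d)) (T : ℕ) (D : ℝ) : UnionIndex d T D → Expert d
  | .inl k => onsExpert K k.1
  | .inr (.inl k) => gdExpert K k.1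
  | .inr (.inr k) => agExpert K k.1

/-- MsMwC-Master run on the union of the three expert sets, `Λ_t` being the whole simplex. -/
def bestOfThree {d : ℕ} (K : Set (Vec d)) (T : ℕ) (D : ℝ) : OnlineAlg d :=
  master (unionExpert K T D) fun _ => stdSimplex ℝ (UnionIndex d T D)

/-! ### Regret and data-dependent quantities -/

/-- `Reg(u) = ∑_t ⟨w_t - u, ℓ_t⟩` over the first `T` rounds. -/
def regret {d : ℕ} (w ℓ : ℕ → Vec d) (T : ℕ) (u : Vec d) : ℝ :=
  ∑ t ∈ Finset.range T, inner ℝ (w t - u) (ℓ t)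

/-- `ℒ_T = ∑_t (ℓ_t - m_t)(ℓ_t - m_t)ᵀ`. -/
def errGram {d : ℕ} (ℓ m : ℕ → Vec d) (T : ℕ) : Matrix (Fin d) (Fin d) ℝ :=
  ∑ t ∈ Finset.range T, outer (ℓ t - m t)

end BestOfThree

end

/-!
The regret of the combined algorithm against `u` splits, for every expert `k`, into the regret of
the master against that expert and the regret of the expert against `u`. The three bounds follow by
choosing a different expert for each of them.

*Master.* A step of the master is multiplicative weights with individual rates, so its minimizer is
positive and satisfies an exact three-point identity for the entropy divergence
(`masterStep_spec`). The correction `b` dominates the stability term of each round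
(`master_round_le`), so the master pays only `32 η_k ∑ ⟨w_t^k, ℓ_t - m_t⟩²` and the divergence from
the prior (`master_regret_le`). Because the prior is proportional to `η²` and the rates are powers
of two, this divergence is `O(L / η_k + L)` (`master_prior_cost_le`), whatever the number of
experts.

*Experts.* Every base step minimizes a linear function plus a positive semidefinite quadratic form,
so a single growth inequality (`isMinOn_add_quadForm_le`) drives all three analyses. Optimistic
gradient descent is two applications of it. Online Newton Step adds the elliptical potential
`log det`, where the rank enters because at most `rank G` factors of `det (8 + G)` differ from `8`
(`det_smul_one_add_le`). AdaGrad uses `tr (1 + G)^{1/2}` as potential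
(`quadForm_inv_le_trace_sub`) and compares matrices by operator monotonicity of the square root
(`quadForm_le_of_quadForm_mul_self_le`). Replacing the loss by the convex cost
`⟨w, ℓ⟩ + 16 η ⟨w, ℓ - m⟩²` (`inner_sub_le_costGrad`) produces a negative term
`-∑ ⟨w_t^k, ℓ_t - m_t⟩²` that cancels what the master charges; for gradient descent the charge is
absorbed directly since `‖w_t^k‖ ≤ 2 ^ d_k`.

*Tuning.* The dyadic grids contain parameters within a factor two of the ideal ones, up to the
lowest grid points, whose contribution is `O(L)` (`exists_two_zpow_mem_Icc`). When `D < 1 / T` the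
gradient descent and AdaGrad families may be empty, but then the Online Newton Step bound is itself
`O(L)`.
-/

noncomputable section

namespace BestOfThree

/-! ### Quadratic forms -/

section Quadratic

variable {d : ℕ}

/-- The bilinear form `uᵀ A v`. -/
def bilForm (A : Matrix (Fin d) (Fin d) ℝ) (u v : Vec d) : ℝ :=
  u.ofLp ⬝ᵥ (A.mulVec v.ofLp)

theorem inner_eq_dotProduct (u v : Vec d) : inner ℝ u v = u.ofLp ⬝ᵥ v.ofLp := by
  rw [EuclideanSpace.inner_eq_star_dotProduct, star_trivial, dotProduct_comm]

theorem norm_sq_eq_dotProduct (u : Vec d) : ‖u‖ ^ 2 = u.ofLp ⬝ᵥ u.ofLp := by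
  rw [← real_inner_self_eq_norm_sq, inner_eq_dotProduct]

theorem bilForm_add_left (A : Matrix (Fin d) (Fin d) ℝ) (u v w : Vec d) :
    bilForm A (u + v) w = bilForm A u w + bilForm A v w := by
  simp [bilForm, add_dotProduct]

theorem bilForm_add_right (A : Matrix (Fin d) (Fin d) ℝ) (u v w : Vec d) :
    bilForm A u (v + w) = bilForm A u v + bilForm A u w := by
  simp [bilForm, Matrix.mulVec_add, dotProduct_add]

theorem bilForm_smul_left (A : Matrix (Fin d) (Fin d) ℝ) (c : ℝ) (u v : Vec d) :
    bilForm A (c • u) v = c * bilForm A u v := by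
  simp [bilForm]

theorem bilForm_smul_right (A : Matrix (Fin d) (Fin d) ℝ) (c : ℝ) (u v : Vec d) :
    bilForm A u (c • v) = c * bilForm A u v := by
  simp [bilForm, Matrix.mulVec_smul]

theorem bilForm_comm {A : Matrix (Fin d) (Fin d) ℝ} (hA : A.IsHermitian) (u v : Vec d) :
    bilForm A u v = bilForm A v u := by
  have hA' : A.transpose = A := by
    rw [← Matrix.conjTranspose_eq_transpose_of_trivial]; exact hA
  unfold bilForm
  rw [Matrix.dotProduct_mulVec, ← Matrix.mulVec_transpose, hA', dotProduct_comm]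

theorem bilForm_self (A : Matrix (Fin d) (Fin d) ℝ) (u : Vec d) :
    bilForm A u u = quadForm A u := rfl

theorem quadForm_add_vec {A : Matrix (Fin d) (Fin d) ℝ} (hA : A.IsHermitian) (u v : Vec d) :
    quadForm A (u + v) = quadForm A u + 2 * bilForm A u v + quadForm A v := by
  rw [← bilForm_self, bilForm_add_left, bilForm_add_right, bilForm_add_right,
    bilForm_comm hA v u, bilForm_self, bilForm_self]
  ring

theorem quadForm_smul_vec (A : Matrix (Fin d) (Fin d) ℝ) (c : ℝ) (u : Vec d) :
    quadForm A (c • u) = c ^ 2 * quadForm A u := by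
  rw [← bilForm_self, bilForm_smul_left, bilForm_smul_right, bilForm_self]
  ring

theorem quadForm_neg_vec (A : Matrix (Fin d) (Fin d) ℝ) (u : Vec d) :
    quadForm A (-u) = quadForm A u := by
  rw [← neg_one_smul ℝ u, quadForm_smul_vec]; ring

theorem quadForm_sub_comm (A : Matrix (Fin d) (Fin d) ℝ) (u v : Vec d) :
    quadForm A (u - v) = quadForm A (v - u) := by
  rw [← neg_sub v u, quadForm_neg_vec]

theorem quadForm_add (A B : Matrix (Fin d) (Fin d) ℝ) (u : Vec d) :
    quadForm (A + B) u = quadForm A u + quadForm B u := by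
  simp [quadForm, Matrix.add_mulVec, dotProduct_add]

theorem quadForm_sub (A B : Matrix (Fin d) (Fin d) ℝ) (u : Vec d) :
    quadForm (A - B) u = quadForm A u - quadForm B u := by
  simp [quadForm, Matrix.sub_mulVec, dotProduct_sub]

theorem quadForm_smul (c : ℝ) (A : Matrix (Fin d) (Fin d) ℝ) (u : Vec d) :
    quadForm (c • A) u = c * quadForm A u := by
  simp [quadForm, Matrix.smul_mulVec, dotProduct_smul]

@[simp]
theorem quadForm_zero (u : Vec d) : quadForm (0 : Matrix (Fin d) (Fin d) ℝ) u = 0 := by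
  simp [quadForm]

@[simp]
theorem quadForm_one (u : Vec d) : quadForm (1 : Matrix (Fin d) (Fin d) ℝ) u = ‖u‖ ^ 2 := by
  simp [quadForm, norm_sq_eq_dotProduct]

theorem quadForm_outer (x u : Vec d) : quadForm (outer x) u = (inner ℝ u x) ^ 2 := by
  simp only [quadForm, outer, Matrix.vecMulVec_mulVec, inner_eq_dotProduct]
  rw [dotProduct_smul, MulOpposite.smul_eq_mul_unop, MulOpposite.unop_op, dotProduct_comm x.ofLp]
  ring

theorem quadForm_sum {ι : Type*} (s : Finset ι) (A : ι → Matrix (Fin d) (Fin d) ℝ) (u : Vec d) :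
    quadForm (∑ i ∈ s, A i) u = ∑ i ∈ s, quadForm (A i) u := by
  classical
  induction s using Finset.induction_on with
  | empty => simp
  | insert a s ha ih => rw [Finset.sum_insert ha, Finset.sum_insert ha, quadForm_add, ih]

theorem quadForm_errGram (ℓ m : ℕ → Vec d) (T : ℕ) (u : Vec d) :
    quadForm (errGram ℓ m T) u = ∑ t ∈ Finset.range T, (inner ℝ u (ℓ t - m t)) ^ 2 := by
  simp [errGram, quadForm_sum, quadForm_outer]

theorem quadForm_nonneg {A : Matrix (Fin d) (Fin d) ℝ} (hA : A.PosSemidef) (u : Vec d) :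
    0 ≤ quadForm A u := by
  simpa [quadForm] using hA.dotProduct_mulVec_nonneg u.ofLp

theorem quadForm_mul_self {A : Matrix (Fin d) (Fin d) ℝ} (hA : A.IsHermitian) (u : Vec d) :
    quadForm (A * A) u = ‖(WithLp.toLp 2 (A.mulVec u.ofLp) : Vec d)‖ ^ 2 := by
  rw [norm_sq_eq_dotProduct, quadForm, ← Matrix.mulVec_mulVec]
  exact bilForm_comm hA u (WithLp.toLp 2 (A.mulVec u.ofLp))

theorem outer_posSemidef (x : Vec d) : (outer x).PosSemidef := by
  have := Matrix.posSemidef_vecMulVec_self_star x.ofLp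
  rwa [star_trivial] at this

theorem trace_outer (x : Vec d) : (outer x).trace = ‖x‖ ^ 2 := by
  rw [outer, Matrix.trace_vecMulVec, norm_sq_eq_dotProduct]

theorem errGram_posSemidef (ℓ m : ℕ → Vec d) (T : ℕ) : (errGram ℓ m T).PosSemidef :=
  Matrix.posSemidef_sum _ fun _ _ => outer_posSemidef _

/-- Cauchy–Schwarz in the form `⟨z, x⟩ ≤ ‖z‖_A² / 2 + ‖x‖_{A⁻¹}² / 2`. -/
theorem inner_le_quadForm_add_inv {A : Matrix (Fin d) (Fin d) ℝ} (hA : A.PosDef) (z x : Vec d) :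
    inner ℝ z x ≤ quadForm A z / 2 + quadForm A⁻¹ x / 2 := by
  set y : Vec d := WithLp.toLp 2 (A⁻¹.mulVec x.ofLp) with hy
  have hAy : A.mulVec y.ofLp = x.ofLp := by
    have := (Matrix.isUnit_iff_isUnit_det A).1 hA.isUnit
    rw [hy, Matrix.mulVec_mulVec, Matrix.mul_nonsing_inv _ this, Matrix.one_mulVec]
  have h0 := quadForm_nonneg hA.posSemidef (z - y)
  rw [sub_eq_add_neg, quadForm_add_vec hA.isHermitian, quadForm_neg_vec] at h0
  have h1 : bilForm A z (-y) = - inner ℝ z x := by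
    rw [← neg_one_smul ℝ y, bilForm_smul_right, bilForm, hAy, inner_eq_dotProduct]; ring
  have h2 : quadForm A y = quadForm A⁻¹ x := by
    rw [quadForm, hAy, quadForm, hy, dotProduct_comm]
  rw [h1, h2] at h0
  linarith

theorem quadForm_smul_inv {A : Matrix (Fin d) (Fin d) ℝ} (hA : A.PosDef) {c : ℝ} (hc : 0 < c)
    (x : Vec d) : quadForm (c • A)⁻¹ x = quadForm A⁻¹ x / c := by
  have hu := (Matrix.isUnit_iff_isUnit_det A).1 hA.isUnit
  have : (c • A)⁻¹ = c⁻¹ • A⁻¹ := by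
    apply Matrix.inv_eq_right_inv
    rw [Matrix.smul_mul, Matrix.mul_smul, smul_smul, mul_inv_cancel₀ hc.ne',
      Matrix.mul_nonsing_inv _ hu, one_smul]
  rw [this, quadForm_smul]; field_simp

/-! ### Minimizers of a linear function plus a quadratic form -/

theorem continuous_quadForm (A : Matrix (Fin d) (Fin d) ℝ) : Continuous (quadForm A) := by
  unfold quadForm dotProduct Matrix.mulVec dotProduct
  fun_prop

/-- The minimizer of a linear function plus a quadratic form has the full quadratic growth
that strong convexity predicts. -/
theorem isMinOn_add_quadForm_le {A : Matrix (Fin d) (Fin d) ℝ} (hA : A.PosSemidef)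
    {Ω : Set (Vec d)} (hΩ : Convex ℝ Ω) {x c w : Vec d} (hw : w ∈ Ω)
    (hmin : IsMinOn (fun w => inner ℝ w x + quadForm A (w - c) / 2) Ω w) {v : Vec d} (hv : v ∈ Ω) :
    inner ℝ w x + quadForm A (w - c) / 2 + quadForm A (v - w) / 2
      ≤ inner ℝ v x + quadForm A (v - c) / 2 := by
  set δ : ℝ := inner ℝ (v - w) x + bilForm A (w - c) (v - w) with hδ
  have key : ∀ s : ℝ, inner ℝ (w + s • (v - w)) x + quadForm A (w + s • (v - w) - c) / 2
      = inner ℝ w x + quadForm A (w - c) / 2 + s * δ + s ^ 2 * (quadForm A (v - w) / 2) := by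
    intro s
    rw [show w + s • (v - w) - c = (w - c) + s • (v - w) by abel,
      quadForm_add_vec hA.isHermitian, bilForm_smul_right, quadForm_smul_vec, inner_add_left,
      real_inner_smul_left]
    ring
  have hq := quadForm_nonneg hA (v - w)
  have hpos : ∀ s : ℝ, 0 < s → s ≤ 1 → 0 ≤ δ + s * (quadForm A (v - w) / 2) := by
    intro s hs hs1
    have hmem : w + s • (v - w) ∈ Ω := hΩ.add_smul_sub_mem hw hv ⟨hs.le, hs1⟩
    have := hmin hmem
    simp only [Set.mem_ofPred_eq] at this
    rw [key s] at this
    have : 0 ≤ s * (δ + s * (quadForm A (v - w) / 2)) := by nlinarith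
    exact nonneg_of_mul_nonneg_right this hs
  have hδ0 : 0 ≤ δ := by
    by_contra hneg
    push Not at hneg
    have h2 := hpos (min 1 (-δ / (quadForm A (v - w) + 1)))
      (lt_min one_pos (div_pos (by linarith) (by linarith))) (min_le_left _ _)
    have h3 : min 1 (-δ / (quadForm A (v - w) + 1)) * (quadForm A (v - w) / 2)
        ≤ (-δ / (quadForm A (v - w) + 1)) * (quadForm A (v - w) / 2) :=
      mul_le_mul_of_nonneg_right (min_le_right _ _) (by linarith)
    have h4 : (-δ / (quadForm A (v - w) + 1)) * (quadForm A (v - w) / 2) ≤ -δ / 2 := by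
      rw [div_mul_eq_mul_div, div_le_iff₀ (by linarith)]
      nlinarith
    linarith
  have h1 := key 1
  rw [one_smul, show w + (v - w) = v by abel] at h1
  rw [h1]; nlinarith

theorem argminOn_quadForm_spec {A : Matrix (Fin d) (Fin d) ℝ}
    {Ω : Set (Vec d)} (hc : IsCompact Ω) (hne : Ω.Nonempty) (x c : Vec d) :
    argminOn (fun w => inner ℝ w x + quadForm A (w - c) / 2) Ω ∈ Ω ∧
      IsMinOn (fun w => inner ℝ w x + quadForm A (w - c) / 2) Ω
        (argminOn (fun w => inner ℝ w x + quadForm A (w - c) / 2) Ω) := by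
  apply argminOn_spec
  apply hc.exists_isMinOn hne
  have := continuous_quadForm A
  fun_prop

theorem hasFDerivAt_quadForm {A : Matrix (Fin d) (Fin d) ℝ} (hA : A.IsHermitian) (w : Vec d) :
    ∃ f : Vec d →L[ℝ] ℝ, HasFDerivAt (quadForm A) f w ∧ ∀ v, f v = 2 * bilForm A w v := by
  let F : Vec d →ₗ[ℝ] ℝ :=
    { toFun := fun v => 2 * bilForm A w v
      map_add' := fun u v => by rw [bilForm_add_right]; ring
      map_smul' := fun c v => by rw [bilForm_smul_right]; simp; ring }
  refine ⟨F.toContinuousLinearMap, ?_, fun v => rfl⟩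
  have hid : ∀ v, quadForm A v = inner ℝ v (Matrix.toEuclideanCLM (n := Fin d) (𝕜 := ℝ) A v) := by
    intro v; rw [inner_eq_dotProduct]; rfl
  have h1 := (hasFDerivAt_id (𝕜 := ℝ) w).inner ℝ
    ((Matrix.toEuclideanCLM (n := Fin d) (𝕜 := ℝ) A).hasFDerivAt (x := w))
  refine (h1.congr_of_eventuallyEq (Filter.Eventually.of_forall hid)).congr_fderiv ?_
  ext v
  simp only [ContinuousLinearMap.coe_comp, Function.comp_apply, ContinuousLinearMap.prod_apply,
    fderivInnerCLM_apply]
  have h2 : inner ℝ w (Matrix.toEuclideanCLM (n := Fin d) (𝕜 := ℝ) A v) = bilForm A w v := by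
    rw [inner_eq_dotProduct]; rfl
  have h3 : inner ℝ v (Matrix.toEuclideanCLM (n := Fin d) (𝕜 := ℝ) A w) = bilForm A v w := by
    rw [inner_eq_dotProduct]; rfl
  simp only [id_eq, ContinuousLinearMap.id_apply, h2, h3, bilForm_comm hA v w]
  change _ = 2 * bilForm A w v
  ring

theorem bregman_quadForm {A : Matrix (Fin d) (Fin d) ℝ} (hA : A.IsHermitian) (u w : Vec d) :
    bregman (fun v => quadForm A v / 2) u w = quadForm A (u - w) / 2 := by
  obtain ⟨f, hf, hfv⟩ := hasFDerivAt_quadForm hA w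
  have h2 : HasFDerivAt (fun v => quadForm A v / 2) ((2 : ℝ)⁻¹ • f) w := by
    have := hf.const_mul (2 : ℝ)⁻¹
    refine this.congr_of_eventuallyEq (Filter.Eventually.of_forall fun v => ?_)
    simp only; ring
  rw [bregman, h2.fderiv]
  simp only [smul_apply, hfv, smul_eq_mul]
  have h3 := quadForm_add_vec hA w (u - w)
  rw [show w + (u - w) = u by abel] at h3
  linarith

end Quadratic

/-! ### Square roots and traces of positive semidefinite matrices -/

section Sqrt

variable {d : ℕ}

open scoped MatrixOrder in
theorem matSqrt_posSemidef (A : Matrix (Fin d) (Fin d) ℝ) : (matSqrt A).PosSemidef :=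
  Matrix.nonneg_iff_posSemidef.1 (CFC.sqrt_nonneg A)

open scoped MatrixOrder in
theorem matSqrt_mul_self {A : Matrix (Fin d) (Fin d) ℝ} (hA : A.PosSemidef) :
    matSqrt A * matSqrt A = A :=
  CFC.sqrt_mul_sqrt_self A hA.nonneg

open scoped MatrixOrder in
theorem matSqrt_one : matSqrt (1 : Matrix (Fin d) (Fin d) ℝ) = 1 :=
  CFC.sqrt_one

/-- The square root is operator monotone. At an eigenvector `v` of `B - A` with a negative
eigenvalue `μ`, `vᵀ (B² - A²) v = μ vᵀ (A + B) v`, which forces `vᵀ A v = vᵀ B v = 0`. -/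
theorem quadForm_le_of_quadForm_mul_self_le {A B : Matrix (Fin d) (Fin d) ℝ}
    (hA : A.PosSemidef) (hB : B.PosSemidef)
    (h : ∀ v : Vec d, quadForm (A * A) v ≤ quadForm (B * B) v) (v : Vec d) :
    quadForm A v ≤ quadForm B v := by
  have hH : (B - A).IsHermitian := hB.isHermitian.sub hA.isHermitian
  have hP : (B - A).PosSemidef := by
    rw [hH.posSemidef_iff_eigenvalues_nonneg]
    intro i
    by_contra hneg
    simp only [Pi.zero_apply, not_le] at hneg
    set μ := hH.eigenvalues i
    set w : Vec d := hH.eigenvectorBasis i with hw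
    have hw1 : ‖w‖ = 1 := hH.eigenvectorBasis.orthonormal.1 i
    have hev : (B - A).mulVec w.ofLp = μ • w.ofLp := hH.mulVec_eigenvectorBasis i
    have hBw : B.mulVec w.ofLp = A.mulVec w.ofLp + μ • w.ofLp := by
      rw [← hev, Matrix.sub_mulVec]; abel
    have h1 := h w
    rw [quadForm_mul_self hA.isHermitian, quadForm_mul_self hB.isHermitian,
      norm_sq_eq_dotProduct, norm_sq_eq_dotProduct] at h1
    have h2 : quadForm B w = quadForm A w + μ := by
      rw [quadForm, hBw, dotProduct_add, dotProduct_smul, ← norm_sq_eq_dotProduct, hw1]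
      simp [quadForm]
    have h3 := quadForm_nonneg hA w
    have h4 := quadForm_nonneg hB w
    have h5 : (B.mulVec w.ofLp) ⬝ᵥ (B.mulVec w.ofLp)
        = (A.mulVec w.ofLp) ⬝ᵥ (A.mulVec w.ofLp) + μ * (quadForm A w + quadForm B w) := by
      rw [h2, hBw]
      simp only [dotProduct_add, add_dotProduct, smul_dotProduct, dotProduct_smul, smul_eq_mul,
        ← norm_sq_eq_dotProduct, hw1]
      rw [dotProduct_comm (A.mulVec w.ofLp) w.ofLp]
      simp only [quadForm]; ring
    simp only at h1
    rw [h5] at h1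
    nlinarith
  have := quadForm_nonneg hP v
  rw [quadForm_sub] at this
  linarith

/-- `A ≤ c² B` implies `√A ≤ c √B`. -/
theorem quadForm_matSqrt_le_mul {A B : Matrix (Fin d) (Fin d) ℝ} (hA : A.PosSemidef)
    (hB : B.PosSemidef) {c : ℝ} (hc : 0 ≤ c)
    (h : ∀ v : Vec d, quadForm A v ≤ c ^ 2 * quadForm B v) (v : Vec d) :
    quadForm (matSqrt A) v ≤ c * quadForm (matSqrt B) v := by
  rw [← quadForm_smul]
  refine quadForm_le_of_quadForm_mul_self_le (matSqrt_posSemidef A)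
    ((matSqrt_posSemidef B).smul hc) (fun v => ?_) v
  rw [matSqrt_mul_self hA, Matrix.smul_mul, Matrix.mul_smul, smul_smul, matSqrt_mul_self hB,
    quadForm_smul, ← sq]
  exact h v

theorem trace_eq_sum_quadForm (A : Matrix (Fin d) (Fin d) ℝ) :
    A.trace = ∑ i, quadForm A (EuclideanSpace.single i (1 : ℝ)) := by
  simp [Matrix.trace, quadForm]

theorem trace_le_of_quadForm_le {A B : Matrix (Fin d) (Fin d) ℝ}
    (h : ∀ v : Vec d, quadForm A v ≤ quadForm B v) : A.trace ≤ B.trace := by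
  rw [trace_eq_sum_quadForm, trace_eq_sum_quadForm]
  exact Finset.sum_le_sum fun i _ => h _

/-- `√(1 + A) ≤ 1 + √A`. -/
theorem quadForm_matSqrt_one_add_le {A : Matrix (Fin d) (Fin d) ℝ} (hA : A.PosSemidef)
    (v : Vec d) : quadForm (matSqrt (1 + A)) v ≤ quadForm (1 + matSqrt A) v := by
  refine quadForm_le_of_quadForm_mul_self_le (matSqrt_posSemidef _)
    (Matrix.PosSemidef.one.add (matSqrt_posSemidef A)) (fun v => ?_) v
  rw [matSqrt_mul_self (Matrix.PosSemidef.one.add hA), Matrix.mul_add, Matrix.add_mul,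
    Matrix.add_mul, matSqrt_mul_self hA]
  simp only [quadForm_add, Matrix.mul_one, Matrix.one_mul]
  have := quadForm_nonneg (matSqrt_posSemidef A) v
  linarith

theorem quadForm_mul_self_le_trace_mul_norm_sq {S : Matrix (Fin d) (Fin d) ℝ} (hS : S.IsHermitian)
    (v : Vec d) : quadForm (S * S) v ≤ (S * S).trace * ‖v‖ ^ 2 := by
  have h1 : (S * S).trace = ∑ i, ∑ j, S i j ^ 2 := by
    simp only [Matrix.trace, Matrix.diag, Matrix.mul_apply]
    refine Finset.sum_congr rfl fun i _ => Finset.sum_congr rfl fun j _ => ?_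
    have := hS.apply i j
    simp only [star_trivial] at this
    rw [this, sq]
  rw [quadForm_mul_self hS, h1, EuclideanSpace.norm_sq_eq, EuclideanSpace.norm_sq_eq,
    Finset.sum_mul]
  refine Finset.sum_le_sum fun i _ => ?_
  simp only [Real.norm_eq_abs, sq_abs]
  exact Finset.sum_mul_sq_le_sq_mul_sq Finset.univ (fun j => S i j) fun j => v j

/-- `R² ≤ tr(R) R` for a positive semidefinite matrix `R`. -/
theorem quadForm_mul_self_le_trace_mul {R : Matrix (Fin d) (Fin d) ℝ} (hR : R.PosSemidef)
    (v : Vec d) : quadForm (R * R) v ≤ R.trace * quadForm R v := by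
  have hS := (matSqrt_posSemidef R).isHermitian
  have h := quadForm_mul_self_le_trace_mul_norm_sq hS
    (WithLp.toLp 2 ((matSqrt R).mulVec v.ofLp))
  rw [← quadForm_mul_self hS, matSqrt_mul_self hR] at h
  refine le_trans (le_of_eq ?_) h
  have hRv : R.mulVec v.ofLp = (matSqrt R).mulVec ((matSqrt R).mulVec v.ofLp) := by
    rw [Matrix.mulVec_mulVec, matSqrt_mul_self hR]
  have h2 := quadForm_mul_self hS (WithLp.toLp 2 ((matSqrt R).mulVec v.ofLp))
  rw [matSqrt_mul_self hR] at h2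
  rw [quadForm_mul_self hR.isHermitian, h2, hRv]

/-- `tr √A ≤ (rank A + tr A) / 2`, since `2 √μ ≤ 1 + μ` for each nonzero eigenvalue `μ`. -/
theorem trace_matSqrt_le {A : Matrix (Fin d) (Fin d) ℝ} (hA : A.PosSemidef) :
    (matSqrt A).trace ≤ ((A.rank : ℝ) + A.trace) / 2 := by
  classical
  set R := matSqrt A with hRdef
  have hR : R.IsHermitian := (matSqrt_posSemidef A).isHermitian
  have hRR : R * R = A := matSqrt_mul_self hA
  have hrank : A.rank = R.rank := by
    rw [← hRR, ← Matrix.rank_conjTranspose_mul_self R, hR.eq]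
  have htr : A.trace = ∑ i, hR.eigenvalues i ^ 2 := by
    have hs := hR.spectral_theorem
    have h1 : A = Unitary.conjStarAlgAut ℝ _ hR.eigenvectorUnitary
        (Matrix.diagonal fun i => hR.eigenvalues i ^ 2) := by
      rw [← hRR]
      conv_lhs => rw [hs, ← map_mul, Matrix.diagonal_mul_diagonal]
      simp [sq]
    rw [h1, Unitary.conjStarAlgAut_apply, Matrix.trace_mul_comm, ← mul_assoc]
    simp [Matrix.trace]
  have htrR : R.trace = ∑ i, hR.eigenvalues i := by
    simpa using hR.trace_eq_sum_eigenvalues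
  have hcard : (R.rank : ℝ) = ∑ i, if hR.eigenvalues i ≠ 0 then (1 : ℝ) else 0 := by
    rw [hR.rank_eq_card_non_zero_eigs, Fintype.card_subtype, Finset.sum_ite]
    simp
  rw [hrank, hcard, htr, htrR, ← Finset.sum_add_distrib, Finset.sum_div]
  refine Finset.sum_le_sum fun i _ => ?_
  split_ifs with h0
  · nlinarith [sq_nonneg (hR.eigenvalues i - 1)]
  · simp only [ne_eq, not_not] at h0
    simp [h0]

theorem trace_mul_outer (A : Matrix (Fin d) (Fin d) ℝ) (x : Vec d) :
    (A * outer x).trace = quadForm A x := by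
  rw [outer, Matrix.mul_vecMulVec, Matrix.trace_vecMulVec, quadForm, dotProduct_comm]

/-- If `Q² = P² + x xᵀ` then `xᵀ Q⁻¹ x ≤ 2 tr(Q - P)`; the difference of the two sides is
`tr(Q⁻¹ (Q - P)²)`. -/
theorem quadForm_inv_le_trace_sub {P Q : Matrix (Fin d) (Fin d) ℝ} (hP : P.PosSemidef)
    (hQ : Q.PosDef) {x : Vec d} (h : Q * Q = P * P + outer x) :
    quadForm Q⁻¹ x ≤ 2 * (Q.trace - P.trace) := by
  have hu := (Matrix.isUnit_iff_isUnit_det Q).1 hQ.isUnit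
  have hx : quadForm Q⁻¹ x = Q.trace - (Q⁻¹ * (P * P)).trace := by
    have h1 : outer x = Q * Q - P * P := by rw [h]; abel
    rw [← trace_mul_outer, h1, Matrix.mul_sub, Matrix.trace_sub,
      Matrix.nonsing_inv_mul_cancel_left _ _ hu]
  have hH : (Q - P).IsHermitian := hQ.isHermitian.sub hP.isHermitian
  have h2 := (hQ.inv.posSemidef.conjTranspose_mul_mul_same (Q - P)).trace_nonneg
  have h3 : (Q - P) * Q⁻¹ * (Q - P) = Q - P - P + P * Q⁻¹ * P := by
    rw [Matrix.sub_mul Q, Matrix.mul_nonsing_inv _ hu, Matrix.sub_mul, Matrix.mul_sub (P * Q⁻¹),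
      Matrix.mul_assoc P Q⁻¹ Q, Matrix.nonsing_inv_mul _ hu, Matrix.mul_one, Matrix.one_mul]
    abel
  have h4 : (P * Q⁻¹ * P).trace = (Q⁻¹ * (P * P)).trace := by
    rw [Matrix.mul_assoc, Matrix.trace_mul_comm, Matrix.mul_assoc]
  rw [hH.eq, h3, Matrix.trace_add, h4, Matrix.trace_sub, Matrix.trace_sub] at h2
  rw [hx]; linarith

theorem matSqrt_one_add_posDef {A : Matrix (Fin d) (Fin d) ℝ} (hA : A.PosSemidef) :
    (matSqrt (1 + A)).PosDef := by
  have hR := matSqrt_posSemidef (1 + A)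
  refine Matrix.PosDef.of_dotProduct_mulVec_pos hR.isHermitian fun {x} hx => ?_
  refine lt_of_le_of_ne (hR.dotProduct_mulVec_nonneg x) fun h0 => hx ?_
  have h1 := (hR.dotProduct_mulVec_zero_iff x).1 h0.symm
  have h2 := quadForm_mul_self hR.isHermitian (WithLp.toLp 2 x)
  rw [matSqrt_mul_self (Matrix.PosSemidef.one.add hA), quadForm_add, quadForm_one] at h2
  simp only [h1, WithLp.toLp_zero, norm_zero] at h2
  have h3 := quadForm_nonneg hA (WithLp.toLp 2 x)
  have h4 : ‖(WithLp.toLp 2 x : Vec d)‖ = 0 := by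
    nlinarith [norm_nonneg (WithLp.toLp 2 x : Vec d)]
  simpa using h4

end Sqrt

/-! ### Gram matrices: rank and determinant -/

section Gram

variable {d : ℕ}

theorem sum_outer_eq_mul_transpose (y : ℕ → Vec d) (T : ℕ) :
    ∑ t ∈ Finset.range T, outer (y t)
      = (Matrix.of fun i (t : Fin T) => y t i) * (Matrix.of fun i (t : Fin T) => y t i).transpose := by
  ext i j
  simp [Matrix.sum_apply, outer, Matrix.vecMulVec_apply, Matrix.mul_apply, Finset.sum_range]

theorem rank_errGram_le (ℓ m : ℕ → Vec d) (T : ℕ) : (errGram ℓ m T).rank ≤ T := by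
  rw [errGram, sum_outer_eq_mul_transpose fun t => ℓ t - m t, Matrix.rank_self_mul_transpose]
  exact Matrix.rank_le_width _

/-- Rescaling the vectors does not increase the rank of their Gram matrix. -/
theorem rank_sum_outer_smul_le (c : ℕ → ℝ) (y : ℕ → Vec d) (T : ℕ) :
    (∑ t ∈ Finset.range T, outer (c t • y t)).rank ≤ (∑ t ∈ Finset.range T, outer (y t)).rank := by
  rw [sum_outer_eq_mul_transpose y, sum_outer_eq_mul_transpose fun t => c t • y t,
    Matrix.rank_self_mul_transpose, Matrix.rank_self_mul_transpose]
  have : (Matrix.of fun i (t : Fin T) => (c t • y t) i)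
      = (Matrix.of fun i (t : Fin T) => y t i) * Matrix.diagonal fun t : Fin T => c t := by
    ext i t
    simp [Matrix.mul_diagonal, mul_comm]
  rw [this]
  exact Matrix.rank_mul_le_left _ _

theorem trace_errGram_eq (ℓ m : ℕ → Vec d) (T : ℕ) :
    (errGram ℓ m T).trace = ∑ t ∈ Finset.range T, ‖ℓ t - m t‖ ^ 2 := by
  simp [errGram, Matrix.trace_sum, trace_outer]

/-- If `c ‖v‖² ≤ ‖v‖_A²` for all `v`, then `‖x‖_{A⁻¹}² ≤ ‖x‖² / c`. -/
theorem quadForm_inv_le {A : Matrix (Fin d) (Fin d) ℝ} (hA : A.PosDef) {c : ℝ} (hc : 0 < c)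
    (h : ∀ v : Vec d, c * ‖v‖ ^ 2 ≤ quadForm A v) (x : Vec d) :
    quadForm A⁻¹ x ≤ ‖x‖ ^ 2 / c := by
  set y : Vec d := WithLp.toLp 2 (A⁻¹.mulVec x.ofLp) with hy
  have hAy : A.mulVec y.ofLp = x.ofLp := by
    have := (Matrix.isUnit_iff_isUnit_det A).1 hA.isUnit
    rw [hy, Matrix.mulVec_mulVec, Matrix.mul_nonsing_inv _ this, Matrix.one_mulVec]
  have h1 : quadForm A⁻¹ x = inner ℝ y x := by
    rw [inner_eq_dotProduct, quadForm, dotProduct_comm]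
  have h2 : quadForm A y = inner ℝ y x := by rw [quadForm, hAy, inner_eq_dotProduct]
  have h3 := h y
  rw [h2] at h3
  rw [h1, le_div_iff₀ hc]
  have h4 : 0 ≤ ‖c • y - x‖ ^ 2 := sq_nonneg _
  rw [norm_sub_sq_real, norm_smul, real_inner_smul_left, mul_pow, Real.norm_eq_abs, sq_abs] at h4
  nlinarith

theorem det_add_outer {A : Matrix (Fin d) (Fin d) ℝ} (hA : A.PosDef) (x : Vec d) :
    (A + outer x).det = A.det * (1 + quadForm A⁻¹ x) := by
  have hu := (Matrix.isUnit_iff_isUnit_det A).1 hA.isUnit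
  have h := Matrix.det_add_replicateCol_mul_replicateRow (ι := Unit) hu x.ofLp x.ofLp
  rw [outer, Matrix.vecMulVec_eq Unit, h, Matrix.det_unique (n := Unit)]
  congr 1
  rw [Matrix.mul_assoc, ← Matrix.replicateCol_mulVec, Matrix.add_apply, Matrix.one_apply_eq,
    Matrix.replicateRow_mul_replicateCol_apply]
  rfl

/-- Only `rank G` of the eigenvalues `c + μ` of `c + G` differ from `c`, and each of them is at most
`c (1 + tr(G) / c)`. -/
theorem det_smul_one_add_le {G : Matrix (Fin d) (Fin d) ℝ} (hG : G.PosSemidef) {c : ℝ}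
    (hc : 0 < c) :
    (c • (1 : Matrix (Fin d) (Fin d) ℝ) + G).det ≤ c ^ d * (1 + G.trace / c) ^ G.rank := by
  classical
  have hH := hG.isHermitian
  have hdet : (c • (1 : Matrix (Fin d) (Fin d) ℝ) + G).det = ∏ i, (c + hH.eigenvalues i) := by
    have h1 := Matrix.eval_charpoly G (-c)
    rw [hH.charpoly_eq, Polynomial.eval_prod] at h1
    simp only [Polynomial.eval_sub, Polynomial.eval_X, Polynomial.eval_C, RCLike.ofReal_real_eq_id,
      id_eq] at h1
    have h2 : Matrix.scalar (Fin d) (-c) - G = -(c • (1 : Matrix (Fin d) (Fin d) ℝ) + G) := by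
      rw [Matrix.scalar_apply, ← Matrix.smul_one_eq_diagonal, neg_smul]; abel
    rw [h2, Matrix.det_neg] at h1
    have h3 : ∏ i, (-c - hH.eigenvalues i) = (-1) ^ d * ∏ i, (c + hH.eigenvalues i) := by
      have h4 : ∏ _i : Fin d, (-1 : ℝ) = (-1) ^ d := by simp
      rw [← h4, ← Finset.prod_mul_distrib]
      exact Finset.prod_congr rfl fun i _ => by ring
    rw [h3, Fintype.card_fin] at h1
    exact (mul_left_cancel₀ (pow_ne_zero d (by norm_num)) h1).symm
  have hnn := hG.eigenvalues_nonneg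
  have htr : G.trace = ∑ i, hH.eigenvalues i := by simpa using hH.trace_eq_sum_eigenvalues
  have hle : ∀ i, c + hH.eigenvalues i
      ≤ c * if hH.eigenvalues i ≠ 0 then 1 + G.trace / c else 1 := by
    intro i
    split_ifs with h0
    · have : hH.eigenvalues i ≤ G.trace := by
        rw [htr]; exact Finset.single_le_sum (fun j _ => hnn j) (Finset.mem_univ i)
      rw [mul_add, mul_div_cancel₀ _ hc.ne']; linarith
    · simp only [ne_eq, not_not] at h0
      simp [h0]
  rw [hdet]
  refine (Finset.prod_le_prod (fun i _ => add_nonneg hc.le (hnn i)) fun i _ => hle i).trans ?_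
  rw [Finset.prod_mul_distrib, Finset.prod_const, Finset.card_fin, Finset.prod_ite,
    Finset.prod_const, Finset.prod_const_one, mul_one, hH.rank_eq_card_non_zero_eigs,
    Fintype.card_subtype]

end Gram

/-! ### Regret of optimistic gradient descent -/

section GD

variable {d : ℕ}

theorem gdStep_spec {Ω : Set (Vec d)} (hc : IsCompact Ω) (hne : Ω.Nonempty) (hΩ : Convex ℝ Ω)
    {η : ℝ} (hη : 0 < η) (c x : Vec d) :
    gdStep Ω η c x ∈ Ω ∧ ∀ v ∈ Ω,
      inner ℝ (gdStep Ω η c x) x + ‖gdStep Ω η c x - c‖ ^ 2 / (2 * η)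
          + ‖v - gdStep Ω η c x‖ ^ 2 / (2 * η)
        ≤ inner ℝ v x + ‖v - c‖ ^ 2 / (2 * η) := by
  have hq : ∀ v : Vec d, quadForm ((1 / η) • (1 : Matrix (Fin d) (Fin d) ℝ)) v / 2
      = ‖v‖ ^ 2 / (2 * η) := by
    intro v
    rw [quadForm_smul, quadForm_one]; field_simp
  have hA : ((1 / η) • (1 : Matrix (Fin d) (Fin d) ℝ)).PosSemidef :=
    Matrix.PosSemidef.one.smul (by positivity)
  have heq : gdStep Ω η c x = argminOn (fun w => inner ℝ w x
      + quadForm ((1 / η) • (1 : Matrix (Fin d) (Fin d) ℝ)) (w - c) / 2) Ω := by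
    unfold gdStep
    congr 1
    funext w
    rw [← bregman_quadForm hA.isHermitian w c]
    simp only [hq]
  obtain ⟨h1, h2⟩ := argminOn_quadForm_spec hc hne x c
    (A := (1 / η) • (1 : Matrix (Fin d) (Fin d) ℝ))
  rw [← heq] at h1 h2
  refine ⟨h1, fun v hv => ?_⟩
  simpa only [hq] using isMinOn_add_quadForm_le hA hΩ h1 h2 hv

theorem optGD_mem {Ω : Set (Vec d)} (hc : IsCompact Ω) (hne : Ω.Nonempty) (hΩ : Convex ℝ Ω)
    {η : ℝ} (hη : 0 < η) (ℓ m : ℕ → Vec d) (t : ℕ) : optGD Ω η ℓ m t ∈ Ω :=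
  (gdStep_spec hc hne hΩ hη _ _).1

theorem optGD_regret_le {Ω : Set (Vec d)} (hc : IsCompact Ω) (hΩ : Convex ℝ Ω)
    {η : ℝ} (hη : 0 < η) (ℓ m : ℕ → Vec d) {u : Vec d} (hu : u ∈ Ω) (T : ℕ) :
    ∑ t ∈ Finset.range T, inner ℝ (optGD Ω η ℓ m t - u) (ℓ t)
      ≤ ‖u‖ ^ 2 / (2 * η) + η / 2 * ∑ t ∈ Finset.range T, ‖ℓ t - m t‖ ^ 2 := by
  suffices h : ∑ t ∈ Finset.range T, inner ℝ (optGD Ω η ℓ m t - u) (ℓ t)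
      ≤ ‖u‖ ^ 2 / (2 * η) - ‖u - gdCenter Ω η ℓ T‖ ^ 2 / (2 * η)
        + η / 2 * ∑ t ∈ Finset.range T, ‖ℓ t - m t‖ ^ 2 by
    have : 0 ≤ ‖u - gdCenter Ω η ℓ T‖ ^ 2 / (2 * η) := by positivity
    linarith
  induction T with
  | zero => simp [gdCenter]
  | succ t ih =>
    rw [Finset.sum_range_succ, Finset.sum_range_succ, mul_add]
    obtain ⟨hw, h1⟩ := gdStep_spec hc ⟨u, hu⟩ hΩ hη (gdCenter Ω η ℓ t) (m t)
    obtain ⟨hw', h2⟩ := gdStep_spec hc ⟨u, hu⟩ hΩ hη (gdCenter Ω η ℓ t) (ℓ t)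
    change ∑ s ∈ Finset.range t, inner ℝ (optGD Ω η ℓ m s - u) (ℓ s)
      + inner ℝ (gdStep Ω η (gdCenter Ω η ℓ t) (m t) - u) (ℓ t)
      ≤ ‖u‖ ^ 2 / (2 * η) - ‖u - gdStep Ω η (gdCenter Ω η ℓ t) (ℓ t)‖ ^ 2 / (2 * η) + _
    have h1 := h1 _ hw'
    have h2 := h2 _ hu
    set w := gdStep Ω η (gdCenter Ω η ℓ t) (m t)
    set w' := gdStep Ω η (gdCenter Ω η ℓ t) (ℓ t)
    have h3 : 0 ≤ ‖(w - w') - η • (ℓ t - m t)‖ ^ 2 / (2 * η) := by positivity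
    rw [norm_sub_sq_real, norm_smul, real_inner_smul_right, mul_pow, Real.norm_eq_abs, sq_abs,
      norm_sub_rev w w'] at h3
    have h4 : (‖w' - w‖ ^ 2 - 2 * (η * inner ℝ (w - w') (ℓ t - m t)) + η ^ 2 * ‖ℓ t - m t‖ ^ 2)
        / (2 * η) = ‖w' - w‖ ^ 2 / (2 * η) - inner ℝ (w - w') (ℓ t - m t)
          + η / 2 * ‖ℓ t - m t‖ ^ 2 := by field_simp
    rw [h4] at h3
    have h5 : 0 ≤ ‖w - gdCenter Ω η ℓ t‖ ^ 2 / (2 * η) := by positivity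
    simp only [inner_sub_left, inner_sub_right] at h1 h2 h3 ih ⊢
    linarith

end GD

/-! ### The auxiliary cost -/

section Cost

variable {d : ℕ}

theorem costGrad_sub (η : ℝ) (ℓ m w : Vec d) :
    costGrad η ℓ m w - m = (1 + 32 * η * inner ℝ w (ℓ - m)) • (ℓ - m) := by
  unfold costGrad; module

/-- Convexity of `c(w) = ⟨w, ℓ⟩ + 16 η ⟨w, ℓ - m⟩²`. -/
theorem inner_sub_le_costGrad {η : ℝ} (hη : 0 ≤ η) (ℓ m w u : Vec d) :
    inner ℝ (w - u) ℓ ≤ inner ℝ (w - u) (costGrad η ℓ m w)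
      + 16 * η * (inner ℝ u (ℓ - m)) ^ 2 - 16 * η * (inner ℝ w (ℓ - m)) ^ 2 := by
  rw [costGrad, inner_add_right, real_inner_smul_right, inner_sub_left w u (ℓ - m)]
  nlinarith [mul_nonneg hη (sq_nonneg (inner ℝ w (ℓ - m) - inner ℝ u (ℓ - m)))]

/-- If `32 η ‖w‖ ≤ ε`, then `∇ - m = c (ℓ - m)` with `|c| ≤ 1 + ε`. -/
theorem sq_one_add_le {η ε : ℝ} (hη : 0 ≤ η) {y w : Vec d} (hy : ‖y‖ ≤ 1)
    (hw : 32 * η * ‖w‖ ≤ ε) : (1 + 32 * η * inner ℝ w y) ^ 2 ≤ (1 + ε) ^ 2 := by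
  have h1 : |inner ℝ w y| ≤ ‖w‖ := (abs_real_inner_le_norm w y).trans
    (mul_le_of_le_one_right (norm_nonneg _) hy)
  have h2 : |32 * η * inner ℝ w y| ≤ ε := by
    rw [abs_mul, abs_of_nonneg (by positivity : 0 ≤ 32 * η)]
    exact (mul_le_mul_of_nonneg_left h1 (by positivity)).trans hw
  rw [abs_le] at h2
  apply sq_le_sq'  <;> linarith

end Cost

/-! ### Regret of Online Newton Step -/

section ONS

variable {d : ℕ}

/-- The matrix `A_t` of the regularizer of Online Newton Step. -/
def onsMat (η : ℝ) (G : Matrix (Fin d) (Fin d) ℝ) : Matrix (Fin d) (Fin d) ℝ :=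
  η • ((8 : ℝ) • (1 : Matrix (Fin d) (Fin d) ℝ) + G)

theorem smul_one_add_posDef {c : ℝ} (hc : 0 < c) {G : Matrix (Fin d) (Fin d) ℝ}
    (hG : G.PosSemidef) : (c • (1 : Matrix (Fin d) (Fin d) ℝ) + G).PosDef :=
  (Matrix.PosDef.one.smul hc).add_posSemidef hG

theorem onsMat_posDef {η : ℝ} (hη : 0 < η) {G : Matrix (Fin d) (Fin d) ℝ}
    (hG : G.PosSemidef) : (onsMat η G).PosDef :=
  (smul_one_add_posDef (by norm_num) hG).smul hη

theorem onsStep_spec {Ω : Set (Vec d)} (hc : IsCompact Ω) (hne : Ω.Nonempty) (hΩ : Convex ℝ Ω)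
    {η : ℝ} (hη : 0 < η) {st : OnsState d} (hG : st.gram.PosSemidef) (x : Vec d) :
    onsStep Ω η st x ∈ Ω ∧ ∀ v ∈ Ω,
      inner ℝ (onsStep Ω η st x) x
          + quadForm (onsMat η st.gram) (onsStep Ω η st x - st.center) / 2
          + quadForm (onsMat η st.gram) (v - onsStep Ω η st x) / 2
        ≤ inner ℝ v x + quadForm (onsMat η st.gram) (v - st.center) / 2 := by
  have hA := (onsMat_posDef hη hG).posSemidef
  have heq : onsStep Ω η st x = argminOn (fun w => inner ℝ w x
      + quadForm (onsMat η st.gram) (w - st.center) / 2) Ω := by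
    unfold onsStep
    congr 1
    funext w
    rw [← bregman_quadForm hA.isHermitian w st.center]
    have : onsReg η st = fun v => quadForm (onsMat η st.gram) v / 2 := by
      funext v
      rw [onsReg, onsMat]
      congr 3
      module
    rw [this]
  obtain ⟨h1, h2⟩ := argminOn_quadForm_spec hc hne x st.center (A := onsMat η st.gram)
  rw [← heq] at h1 h2
  exact ⟨h1, fun v hv => isMinOn_add_quadForm_le hA hΩ h1 h2 hv⟩

/-- The vector `∇_t - m_t` of Online Newton Step. -/
def onsDiff (Ω : Set (Vec d)) (η : ℝ) (ℓ m : ℕ → Vec d) (t : ℕ) : Vec d :=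
  costGrad η (ℓ t) (m t) (ons Ω η ℓ m t) - m t

theorem onsState_gram (Ω : Set (Vec d)) (η : ℝ) (ℓ m : ℕ → Vec d) (t : ℕ) :
    (onsState Ω η ℓ m t).gram = ∑ s ∈ Finset.range t, outer (onsDiff Ω η ℓ m s) := by
  induction t with
  | zero => rfl
  | succ t ih => rw [Finset.sum_range_succ, ← ih]; rfl

theorem onsState_gram_posSemidef (Ω : Set (Vec d)) (η : ℝ) (ℓ m : ℕ → Vec d) (t : ℕ) :
    (onsState Ω η ℓ m t).gram.PosSemidef := by
  rw [onsState_gram]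
  exact Matrix.posSemidef_sum _ fun _ _ => outer_posSemidef _

theorem ons_mem {Ω : Set (Vec d)} (hc : IsCompact Ω) (hne : Ω.Nonempty) (hΩ : Convex ℝ Ω)
    {η : ℝ} (hη : 0 < η) (ℓ m : ℕ → Vec d) (t : ℕ) : ons Ω η ℓ m t ∈ Ω :=
  (onsStep_spec hc hne hΩ hη (onsState_gram_posSemidef Ω η ℓ m t) _).1

theorem le_two_mul_log_one_add {z : ℝ} (h0 : 0 ≤ z) (h1 : z ≤ 1) : z ≤ 2 * Real.log (1 + z) := by
  have h := Real.one_sub_inv_le_log_of_pos (by linarith : 0 < 1 + z)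
  have h2 : 1 - (1 + z)⁻¹ = z / (1 + z) := by field_simp; ring
  have h3 : z / 2 ≤ z / (1 + z) := div_le_div_of_nonneg_left h0 (by linarith) (by linarith)
  linarith

/-- The elliptical potential lemma, with the logarithm of the determinant as potential. -/
theorem sum_quadForm_inv_le_log_det (x : ℕ → Vec d) (T : ℕ) (hx : ∀ t < T, ‖x t‖ ^ 2 ≤ 4) :
    ∑ t ∈ Finset.range T,
        quadForm ((8 : ℝ) • (1 : Matrix (Fin d) (Fin d) ℝ)
          + ∑ s ∈ Finset.range t, outer (x s))⁻¹ (x t)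
      ≤ 2 * Real.log (((8 : ℝ) • (1 : Matrix (Fin d) (Fin d) ℝ)
          + ∑ s ∈ Finset.range T, outer (x s)).det / 8 ^ d) := by
  induction T with
  | zero => simp
  | succ t ih =>
    have hA := smul_one_add_posDef (by norm_num : (0 : ℝ) < 8)
      (Matrix.posSemidef_sum (Finset.range t) fun s _ => outer_posSemidef (x s))
    rw [Finset.sum_range_succ, Finset.sum_range_succ (fun s => outer (x s)), ← add_assoc,
      det_add_outer hA, mul_div_right_comm]
    have h0 := quadForm_nonneg hA.inv.posSemidef (x t)
    have h1 := quadForm_inv_le hA (by norm_num : (0 : ℝ) < 8) (fun v => by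
      rw [quadForm_add, quadForm_smul, quadForm_one]
      have := quadForm_nonneg
        (Matrix.posSemidef_sum (Finset.range t) fun s _ => outer_posSemidef (x s)) v
      linarith) (x t)
    have h2 := hx t (Nat.lt_succ_self t)
    have h3 := le_two_mul_log_one_add h0 (by linarith)
    have h4 := ih fun s hs => hx s (hs.trans (Nat.lt_succ_self t))
    rw [Real.log_mul (div_pos hA.det_pos (by positivity)).ne' (by linarith)]
    linarith

theorem sum_quadForm_inv_le_rank_mul_log (x : ℕ → Vec d) (T : ℕ) (hx : ∀ t < T, ‖x t‖ ^ 2 ≤ 4) :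
    ∑ t ∈ Finset.range T,
        quadForm ((8 : ℝ) • (1 : Matrix (Fin d) (Fin d) ℝ)
          + ∑ s ∈ Finset.range t, outer (x s))⁻¹ (x t)
      ≤ 2 * ((∑ t ∈ Finset.range T, outer (x t)).rank * Real.log (1 + T)) := by
  refine (sum_quadForm_inv_le_log_det x T hx).trans ?_
  have hG := Matrix.posSemidef_sum (Finset.range T) fun s _ => outer_posSemidef (x s)
  have hA := smul_one_add_posDef (by norm_num : (0 : ℝ) < 8) hG
  have htr : (∑ s ∈ Finset.range T, outer (x s)).trace ≤ 4 * T := by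
    rw [Matrix.trace_sum]
    simp only [trace_outer]
    refine (Finset.sum_le_sum fun t ht => hx t (Finset.mem_range.1 ht)).trans ?_
    simp [mul_comm]
  have h0 := hG.trace_nonneg
  rw [← Real.log_pow]
  have h8 : (0 : ℝ) < 8 ^ d := by positivity
  refine mul_le_mul_of_nonneg_left (Real.log_le_log (div_pos hA.det_pos h8) ?_) (by norm_num)
  rw [div_le_iff₀ h8, mul_comm]
  refine (det_smul_one_add_le hG (by norm_num)).trans (mul_le_mul_of_nonneg_left ?_ h8.le)
  exact pow_le_pow_left₀ (by positivity) (by linarith [(Nat.cast_nonneg T : (0 : ℝ) ≤ T)]) _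

theorem sq_sub_add_le (a b c : ℝ) : (a - b + c) ^ 2 ≤ 3 * (a ^ 2 + b ^ 2 + c ^ 2) := by
  nlinarith [sq_nonneg (a + b), sq_nonneg (a - c), sq_nonneg (b + c)]

set_option maxHeartbeats 400000 in
/-- One round of Online Newton Step. -/
theorem ons_round_le {Ω : Set (Vec d)} (hc : IsCompact Ω) (hΩ : Convex ℝ Ω)
    {η : ℝ} (hη : 0 < η) (hΩη : ∀ w ∈ Ω, 32 * η * ‖w‖ ≤ 3 / 4) (ℓ m : ℕ → Vec d)
    {u : Vec d} (hu : u ∈ Ω) {t : ℕ} (hy : ‖ℓ t - m t‖ ≤ 1) :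
    inner ℝ (ons Ω η ℓ m t - u) (ℓ t)
      ≤ quadForm (onsMat η (onsState Ω η ℓ m t).gram) (u - (onsState Ω η ℓ m t).center) / 2
        - quadForm (onsMat η (onsState Ω η ℓ m (t + 1)).gram)
            (u - (onsState Ω η ℓ m (t + 1)).center) / 2
        + 21 * η * inner ℝ u (ℓ t - m t) ^ 2
        - 32 / 3 * η * inner ℝ (ons Ω η ℓ m t) (ℓ t - m t) ^ 2
        + 7 / 4 * (quadForm ((8 : ℝ) • (1 : Matrix (Fin d) (Fin d) ℝ)
            + (onsState Ω η ℓ m t).gram)⁻¹ (onsDiff Ω η ℓ m t) / η) := by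
  have hG := onsState_gram_posSemidef Ω η ℓ m t
  have hB := smul_one_add_posDef (by norm_num : (0 : ℝ) < 8) hG
  have hA := onsMat_posDef hη hG
  obtain ⟨hw, h1⟩ := onsStep_spec hc ⟨u, hu⟩ hΩ hη hG (m t)
  obtain ⟨hw', h2⟩ := onsStep_spec hc ⟨u, hu⟩ hΩ hη hG
    (costGrad η (ℓ t) (m t) (ons Ω η ℓ m t))
  have hcent : (onsState Ω η ℓ m (t + 1)).center
      = onsStep Ω η (onsState Ω η ℓ m t) (costGrad η (ℓ t) (m t) (ons Ω η ℓ m t)) := rfl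
  have hgram : onsMat η (onsState Ω η ℓ m (t + 1)).gram
      = onsMat η (onsState Ω η ℓ m t).gram + η • outer (onsDiff Ω η ℓ m t) := by
    rw [onsState_gram, Finset.sum_range_succ, ← onsState_gram, onsMat, onsMat, ← add_assoc,
      smul_add η (_ + _)]
  change ons Ω η ℓ m t ∈ Ω at hw
  have h1a := h1 _ hw'
  have h2a := h2 _ hu
  have h2b := h2 _ hw
  change inner ℝ (ons Ω η ℓ m t) (m t)
    + quadForm (onsMat η (onsState Ω η ℓ m t).gram) (ons Ω η ℓ m t - _) / 2
    + quadForm (onsMat η (onsState Ω η ℓ m t).gram) (_ - ons Ω η ℓ m t) / 2 ≤ _ at h1a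
  rw [hcent, hgram, quadForm_add, quadForm_smul, quadForm_outer]
  have hxdef : onsDiff Ω η ℓ m t = costGrad η (ℓ t) (m t) (ons Ω η ℓ m t) - m t := rfl
  have hxy : onsDiff Ω η ℓ m t
      = (1 + 32 * η * inner ℝ (ons Ω η ℓ m t) (ℓ t - m t)) • (ℓ t - m t) := costGrad_sub _ _ _ _
  have hcost := inner_sub_le_costGrad hη.le (ℓ t) (m t) (ons Ω η ℓ m t) u
  have hc2 := sq_one_add_le hη.le hy (hΩη _ hw)
  have hinv := inner_le_quadForm_add_inv hA (ons Ω η ℓ m t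
    - onsStep Ω η (onsState Ω η ℓ m t) (costGrad η (ℓ t) (m t) (ons Ω η ℓ m t)))
    (onsDiff Ω η ℓ m t)
  have hsmul : quadForm (onsMat η (onsState Ω η ℓ m t).gram)⁻¹ (onsDiff Ω η ℓ m t)
      = quadForm ((8 : ℝ) • (1 : Matrix (Fin d) (Fin d) ℝ)
            + (onsState Ω η ℓ m t).gram)⁻¹ (onsDiff Ω η ℓ m t) / η :=
    quadForm_smul_inv hB hη _
  rw [← hsmul]
  have hN := quadForm_inv_le hA (by positivity : 0 < 8 * η) (fun v => by
    rw [onsMat, quadForm_smul, quadForm_add, quadForm_smul, quadForm_one]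
    nlinarith [quadForm_nonneg hG v]) (onsDiff Ω η ℓ m t)
  have hx2 : ‖onsDiff Ω η ℓ m t‖ ^ 2 ≤ 4 := by
    rw [hxy, norm_smul, mul_pow, Real.norm_eq_abs, sq_abs]
    have : ‖ℓ t - m t‖ ^ 2 ≤ 1 := by nlinarith [norm_nonneg (ℓ t - m t)]
    nlinarith [sq_nonneg ‖ℓ t - m t‖]
  rw [quadForm_sub_comm _ (ons Ω η ℓ m t) (onsStep _ _ _ _)] at h2b hinv
  set w := ons Ω η ℓ m t
  set A := onsMat η (onsState Ω η ℓ m t).gram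
  set g := costGrad η (ℓ t) (m t) w
  set w' := onsStep Ω η (onsState Ω η ℓ m t) g
  set c := (onsState Ω η ℓ m t).center
  set N := quadForm A⁻¹ (onsDiff Ω η ℓ m t)
  set z := inner ℝ (w - w') (onsDiff Ω η ℓ m t) with hz
  set κ := 1 + 32 * η * inner ℝ w (ℓ t - m t)
  have hzdef : z = inner ℝ w g - inner ℝ w (m t) - inner ℝ w' g + inner ℝ w' (m t) := by
    rw [hz, hxdef]; simp only [inner_sub_left, inner_sub_right]; ring
  -- Adding the two optimality conditions bounds `‖w - w'‖_A²` by `⟨w - w', ∇ - m⟩`.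
  have hq : quadForm A (w' - w) ≤ z := by linarith
  have hz0 : 0 ≤ z := (quadForm_nonneg hA.posSemidef _).trans hq
  have hzN : z ≤ N := by linarith
  have hN2 : η * N ≤ 1 / 2 := by
    rw [le_div_iff₀ (by positivity)] at hN
    linarith
  have hz2 : η * z ^ 2 ≤ N / 2 := by
    have h3 := mul_le_mul_of_nonneg_left (pow_le_pow_left₀ hz0 hzN 2) hη.le
    have h4 := mul_le_mul_of_nonneg_right hN2 (hz0.trans hzN)
    linarith
  -- `u - w' = (u - w) + (w - w')`, so the growth of the regularizer is charged to the two squares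
  -- in the auxiliary cost and to the stability term.
  have hsplit : inner ℝ (u - w') (onsDiff Ω η ℓ m t)
      = κ * inner ℝ u (ℓ t - m t) - κ * inner ℝ w (ℓ t - m t) + z := by
    rw [← real_inner_smul_right, ← real_inner_smul_right, ← hxy, hz]
    simp only [inner_sub_left]; ring
  have hsq : η * inner ℝ (u - w') (onsDiff Ω η ℓ m t) ^ 2
      ≤ 3 * (η * (49 / 16 * inner ℝ u (ℓ t - m t) ^ 2)
        + η * (49 / 16 * inner ℝ w (ℓ t - m t) ^ 2) + N / 2) := by
    rw [hsplit]
    generalize inner ℝ u (ℓ t - m t) = a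
    generalize hb : inner ℝ w (ℓ t - m t) = b
    have e1 := sq_sub_add_le (κ * a) (κ * b) z
    have e2 : (κ * a) ^ 2 ≤ 49 / 16 * a ^ 2 := by
      rw [mul_pow]; refine mul_le_mul_of_nonneg_right (hc2.trans (by norm_num)) (sq_nonneg _)
    have e3 : (κ * b) ^ 2 ≤ 49 / 16 * b ^ 2 := by
      rw [mul_pow]; refine mul_le_mul_of_nonneg_right (hc2.trans (by norm_num)) (sq_nonneg _)
    have e4 := mul_le_mul_of_nonneg_left e1 hη.le
    have e5 := mul_le_mul_of_nonneg_left e2 hη.le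
    have e6 := mul_le_mul_of_nonneg_left e3 hη.le
    linarith
  have hp1 : 0 ≤ η * inner ℝ u (ℓ t - m t) ^ 2 := by positivity
  have hp2 : 0 ≤ η * inner ℝ w (ℓ t - m t) ^ 2 := by positivity
  have hq1 := quadForm_nonneg hA.posSemidef (w - c)
  have hq2 := quadForm_nonneg hA.posSemidef (w' - w)
  rw [inner_sub_left w u g] at hcost
  linarith

/-- When `η` is three times the learning rate that the master assigns to the expert, the negative
term is exactly what cancels the correction `32 η_k ∑ ⟨w_t, ℓ_t - m_t⟩²` of the master. -/
theorem ons_regret_le {Ω : Set (Vec d)} (hc : IsCompact Ω) (hΩ : Convex ℝ Ω)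
    {η : ℝ} (hη : 0 < η) (hΩη : ∀ w ∈ Ω, 32 * η * ‖w‖ ≤ 3 / 4) (ℓ m : ℕ → Vec d)
    {u : Vec d} (hu : u ∈ Ω) {T : ℕ} (hy : ∀ t < T, ‖ℓ t - m t‖ ≤ 1) :
    ∑ t ∈ Finset.range T, inner ℝ (ons Ω η ℓ m t - u) (ℓ t)
      ≤ 4 * η * ‖u‖ ^ 2 + 21 * η * ∑ t ∈ Finset.range T, inner ℝ u (ℓ t - m t) ^ 2
        - 32 / 3 * η * ∑ t ∈ Finset.range T, inner ℝ (ons Ω η ℓ m t) (ℓ t - m t) ^ 2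
        + 7 / 2 * ((errGram ℓ m T).rank * Real.log (1 + T) / η) := by
  have h1 := Finset.sum_le_sum fun t (ht : t ∈ Finset.range T) =>
    ons_round_le hc hΩ hη hΩη ℓ m hu (hy t (Finset.mem_range.1 ht))
  refine h1.trans ?_
  rw [Finset.sum_add_distrib, Finset.sum_sub_distrib, Finset.sum_add_distrib,
    Finset.sum_range_sub', ← Finset.mul_sum, ← Finset.mul_sum, ← Finset.mul_sum, ← Finset.sum_div]
  have h0 : quadForm (onsMat η (onsState Ω η ℓ m 0).gram) (u - (onsState Ω η ℓ m 0).center)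
      = 8 * η * ‖u‖ ^ 2 := by
    simp only [onsState, onsMat, quadForm_smul, add_zero, quadForm_one, sub_zero]; ring
  have hT := quadForm_nonneg (onsMat_posDef hη (onsState_gram_posSemidef Ω η ℓ m T)).posSemidef
    (u - (onsState Ω η ℓ m T).center)
  have hxy : ∀ t, onsDiff Ω η ℓ m t
      = (1 + 32 * η * inner ℝ (ons Ω η ℓ m t) (ℓ t - m t)) • (ℓ t - m t) :=
    fun t => costGrad_sub _ _ _ _
  have h2 := sum_quadForm_inv_le_rank_mul_log (onsDiff Ω η ℓ m) T fun t ht => by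
    have hw := ons_mem hc ⟨u, hu⟩ hΩ hη ℓ m t
    have hc2 := sq_one_add_le hη.le (hy t ht) (hΩη _ hw)
    rw [hxy, norm_smul, mul_pow, Real.norm_eq_abs, sq_abs]
    have : ‖ℓ t - m t‖ ^ 2 ≤ 1 := by nlinarith [norm_nonneg (ℓ t - m t), hy t ht]
    nlinarith [sq_nonneg ‖ℓ t - m t‖]
  simp only [← onsState_gram] at h2
  have hr : ((onsState Ω η ℓ m T).gram.rank : ℝ) ≤ (errGram ℓ m T).rank := by
    rw [onsState_gram]
    simp only [hxy]
    exact_mod_cast rank_sum_outer_smul_le _ (fun t => ℓ t - m t) T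
  have hlog : 0 ≤ Real.log (1 + T) := Real.log_nonneg (by simp)
  have h3 := mul_le_mul_of_nonneg_right hr hlog
  have h4 := (div_le_div_iff_of_pos_right hη).2 (h2.trans (mul_le_mul_of_nonneg_left h3 zero_le_two))
  rw [mul_div_assoc] at h4
  linarith

end ONS

/-! ### Regret of optimistic AdaGrad -/

section AdaGrad

variable {d : ℕ}

theorem agStep_spec {Ω : Set (Vec d)} (hc : IsCompact Ω) (hne : Ω.Nonempty) (hΩ : Convex ℝ Ω)
    {η : ℝ} (hη : 0 < η) (st : AgState d) (x : Vec d) :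
    agStep Ω η st x ∈ Ω ∧ ∀ v ∈ Ω,
      inner ℝ (agStep Ω η st x) (st.gradSum + x)
          + quadForm (matSqrt (1 + st.gram)) (agStep Ω η st x) / (2 * η)
          + quadForm (matSqrt (1 + st.gram)) (v - agStep Ω η st x) / (2 * η)
        ≤ inner ℝ v (st.gradSum + x) + quadForm (matSqrt (1 + st.gram)) v / (2 * η) := by
  have hA : ((1 / η) • matSqrt (1 + st.gram)).PosSemidef :=
    (matSqrt_posSemidef _).smul (by positivity)
  have hq : ∀ v, quadForm ((1 / η) • matSqrt (1 + st.gram)) v / 2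
      = quadForm (matSqrt (1 + st.gram)) v / (2 * η) := by
    intro v
    rw [quadForm_smul]; field_simp
  have heq : agStep Ω η st x = argminOn (fun w => inner ℝ w (st.gradSum + x)
      + quadForm ((1 / η) • matSqrt (1 + st.gram)) (w - 0) / 2) Ω := by
    simp only [sub_zero]; rfl
  obtain ⟨h1, h2⟩ := argminOn_quadForm_spec hc hne (st.gradSum + x) 0
    (A := (1 / η) • matSqrt (1 + st.gram))
  rw [← heq] at h1 h2
  refine ⟨h1, fun v hv => ?_⟩
  simpa only [sub_zero, hq] using isMinOn_add_quadForm_le hA hΩ h1 h2 hv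

/-- The vector `∇_t - m_t` of AdaGrad. -/
def agDiff (Ω : Set (Vec d)) (η η' : ℝ) (ℓ m : ℕ → Vec d) (t : ℕ) : Vec d :=
  costGrad η' (ℓ t) (m t) (adaGrad Ω η η' ℓ m t) - m t

theorem agState_gram (Ω : Set (Vec d)) (η η' : ℝ) (ℓ m : ℕ → Vec d) (t : ℕ) :
    (agState Ω η η' ℓ m t).gram = ∑ s ∈ Finset.range t, outer (agDiff Ω η η' ℓ m s) := by
  induction t with
  | zero => rfl
  | succ t ih => rw [Finset.sum_range_succ, ← ih]; rfl

theorem agState_gram_posSemidef (Ω : Set (Vec d)) (η η' : ℝ) (ℓ m : ℕ → Vec d) (t : ℕ) :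
    (agState Ω η η' ℓ m t).gram.PosSemidef := by
  rw [agState_gram]
  exact Matrix.posSemidef_sum _ fun _ _ => outer_posSemidef _

theorem adaGrad_mem {Ω : Set (Vec d)} (hc : IsCompact Ω) (hne : Ω.Nonempty) (hΩ : Convex ℝ Ω)
    {η : ℝ} (hη : 0 < η) (η' : ℝ) (ℓ m : ℕ → Vec d) (t : ℕ) : adaGrad Ω η η' ℓ m t ∈ Ω :=
  (agStep_spec hc hne hΩ hη _ _).1

/-- The stability term of a round with `P = (1 + G)^{1/2}` and `Q = (1 + G + x xᵀ)^{1/2}` is paid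
for by the increase of the trace. -/
theorem inner_sub_quadForm_le_trace_sub {G : Matrix (Fin d) (Fin d) ℝ} (hG : G.PosSemidef)
    {η : ℝ} (hη : 0 < η) {x : Vec d} (hx : ‖x‖ ^ 2 ≤ 3) (z : Vec d) :
    inner ℝ z x - quadForm (matSqrt (1 + G)) z / (2 * η)
      ≤ 2 * η * ((matSqrt (1 + (G + outer x))).trace - (matSqrt (1 + G)).trace) := by
  have hG' := hG.add (outer_posSemidef x)
  have hQ := matSqrt_one_add_posDef hG'
  have h1 := quadForm_inv_le_trace_sub (matSqrt_posSemidef (1 + G)) hQ (x := x) (by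
    rw [matSqrt_mul_self (Matrix.PosSemidef.one.add hG'),
      matSqrt_mul_self (Matrix.PosSemidef.one.add hG), add_assoc])
  have h2 := quadForm_matSqrt_le_mul (Matrix.PosSemidef.one.add hG')
    (Matrix.PosSemidef.one.add hG) (zero_le_two) (fun v => by
      rw [quadForm_add, quadForm_add, quadForm_add, quadForm_one, quadForm_outer]
      have h3 : inner ℝ v x ^ 2 ≤ ‖v‖ ^ 2 * ‖x‖ ^ 2 := by
        rw [← mul_pow, ← sq_abs]
        exact pow_le_pow_left₀ (abs_nonneg _) (abs_real_inner_le_norm v x) 2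
      have h4 := mul_le_mul_of_nonneg_left hx (sq_nonneg ‖v‖)
      have h5 := quadForm_nonneg hG v
      linarith) z
  have h2η : 0 < 1 / (2 * η) := by positivity
  have h3 := inner_le_quadForm_add_inv (hQ.smul h2η) z x
  rw [quadForm_smul_inv hQ h2η, quadForm_smul] at h3
  have h4 : quadForm (matSqrt (1 + (G + outer x)))⁻¹ x / (1 / (2 * η)) / 2
      = η * quadForm (matSqrt (1 + (G + outer x)))⁻¹ x := by field_simp
  have h5 : 1 / (2 * η) * quadForm (matSqrt (1 + (G + outer x))) z / 2
      ≤ quadForm (matSqrt (1 + G)) z / (2 * η) := by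
    rw [div_mul_eq_mul_div, one_mul, div_right_comm]
    exact div_le_div_of_nonneg_right (by linarith) (by positivity)
  have h6 := mul_le_mul_of_nonneg_left h1 hη.le
  rw [h4] at h3
  linarith

/-- Follow-the-regularized-leader analysis: the left side, plus the trace terms, is a lower bound
for the regularized cumulative loss of every comparator, by induction over the rounds. -/
theorem sum_inner_costGrad_le {Ω : Set (Vec d)} (hc : IsCompact Ω) (hΩ : Convex ℝ Ω)
    {η η' : ℝ} (hη : 0 < η) (ℓ m : ℕ → Vec d) (T : ℕ)
    (hx : ∀ t < T, ‖agDiff Ω η η' ℓ m t‖ ^ 2 ≤ 3) {u : Vec d} (hu : u ∈ Ω) :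
    ∑ t ∈ Finset.range T, inner ℝ (adaGrad Ω η η' ℓ m t)
        (costGrad η' (ℓ t) (m t) (adaGrad Ω η η' ℓ m t))
      ≤ inner ℝ u (agState Ω η η' ℓ m T).gradSum
        + quadForm (matSqrt (1 + (agState Ω η η' ℓ m T).gram)) u / (2 * η)
        + 2 * η * ((matSqrt (1 + (agState Ω η η' ℓ m T).gram)).trace
          - (matSqrt (1 : Matrix (Fin d) (Fin d) ℝ)).trace) := by
  induction T generalizing u with
  | zero =>
    have := div_nonneg (quadForm_nonneg (matSqrt_posSemidef 1) u) (by positivity : 0 ≤ 2 * η)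
    simpa [agState] using this
  | succ t ih =>
    have hG := agState_gram_posSemidef Ω η η' ℓ m t
    have hG' := agState_gram_posSemidef Ω η η' ℓ m (t + 1)
    obtain ⟨hw, h1⟩ := agStep_spec hc ⟨u, hu⟩ hΩ hη (agState Ω η η' ℓ m t) (m t)
    have h1 := h1 u hu
    have hgram : (agState Ω η η' ℓ m (t + 1)).gram
        = (agState Ω η η' ℓ m t).gram + outer (agDiff Ω η η' ℓ m t) := rfl
    have hgrad : (agState Ω η η' ℓ m (t + 1)).gradSum = (agState Ω η η' ℓ m t).gradSum
        + costGrad η' (ℓ t) (m t) (adaGrad Ω η η' ℓ m t) := rfl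
    have hdiff : agDiff Ω η η' ℓ m t
        = costGrad η' (ℓ t) (m t) (adaGrad Ω η η' ℓ m t) - m t := rfl
    have hst := inner_sub_quadForm_le_trace_sub hG hη (hx t (Nat.lt_succ_self t))
      (adaGrad Ω η η' ℓ m t - u)
    have hmono := quadForm_matSqrt_le_mul (Matrix.PosSemidef.one.add hG)
      (Matrix.PosSemidef.one.add hG') zero_le_one (fun v => by
        rw [hgram, ← add_assoc, quadForm_add _ (outer _)]
        have := quadForm_nonneg (outer_posSemidef (agDiff Ω η η' ℓ m t)) v
        linarith) u
    rw [one_mul] at hmono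
    have hmono2 := div_le_div_of_nonneg_right hmono (by positivity : 0 ≤ 2 * η)
    rw [Finset.sum_range_succ]
    change adaGrad Ω η η' ℓ m t ∈ Ω at hw
    have h0 := ih (fun s hs => hx s (hs.trans (Nat.lt_succ_self t))) hw
    change inner ℝ (adaGrad Ω η η' ℓ m t) _
      + quadForm _ (adaGrad Ω η η' ℓ m t) / (2 * η)
      + quadForm _ (u - adaGrad Ω η η' ℓ m t) / (2 * η) ≤ _ at h1
    rw [quadForm_sub_comm _ u] at h1
    rw [hgrad]
    rw [← hgram] at hst
    rw [hdiff] at hst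
    simp only [inner_sub_left, inner_sub_right, inner_add_right] at h1 hst h0 ⊢
    linarith

theorem agState_gradSum (Ω : Set (Vec d)) (η η' : ℝ) (ℓ m : ℕ → Vec d) (T : ℕ) :
    (agState Ω η η' ℓ m T).gradSum = ∑ t ∈ Finset.range T,
      costGrad η' (ℓ t) (m t) (adaGrad Ω η η' ℓ m t) := by
  induction T with
  | zero => rfl
  | succ t ih => rw [Finset.sum_range_succ, ← ih]; rfl

/-- When `η'` is twice the learning rate that the master assigns to the expert, the negative term
cancels the correction of the master. The bound is stated through `errGram` because
`∇_t - m_t` is a multiple of `ℓ_t - m_t` by a factor at most `3 / 2`. -/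
theorem adaGrad_regret_le {Ω : Set (Vec d)} (hc : IsCompact Ω) (hΩ : Convex ℝ Ω)
    {η η' : ℝ} (hη : 0 < η) (hη' : 0 < η') (hΩη : ∀ w ∈ Ω, 32 * η' * ‖w‖ ≤ 1 / 2)
    (ℓ m : ℕ → Vec d) {u : Vec d} (hu : u ∈ Ω) {T : ℕ} (hy : ∀ t < T, ‖ℓ t - m t‖ ≤ 1) :
    ∑ t ∈ Finset.range T, inner ℝ (adaGrad Ω η η' ℓ m t - u) (ℓ t)
      ≤ 3 / 4 * (quadForm (matSqrt (1 + errGram ℓ m T)) u / η)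
        + 3 * η * (matSqrt (errGram ℓ m T)).trace
        + 16 * η' * ∑ t ∈ Finset.range T, inner ℝ u (ℓ t - m t) ^ 2
        - 16 * η' * ∑ t ∈ Finset.range T, inner ℝ (adaGrad Ω η η' ℓ m t) (ℓ t - m t) ^ 2 := by
  have hxy : ∀ t, agDiff Ω η η' ℓ m t
      = (1 + 32 * η' * inner ℝ (adaGrad Ω η η' ℓ m t) (ℓ t - m t)) • (ℓ t - m t) :=
    fun t => costGrad_sub _ _ _ _
  have hc2 : ∀ t < T, (1 + 32 * η' * inner ℝ (adaGrad Ω η η' ℓ m t) (ℓ t - m t)) ^ 2 ≤ 9 / 4 :=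
    fun t ht => (sq_one_add_le hη'.le (hy t ht)
      (hΩη _ (adaGrad_mem hc ⟨u, hu⟩ hΩ hη η' ℓ m t))).trans (by norm_num)
  have hG := agState_gram_posSemidef Ω η η' ℓ m T
  have hE := errGram_posSemidef ℓ m T
  have hGE : ∀ v : Vec d, quadForm (agState Ω η η' ℓ m T).gram v
      ≤ 9 / 4 * quadForm (errGram ℓ m T) v := by
    intro v
    rw [agState_gram, quadForm_sum, quadForm_errGram, Finset.mul_sum]
    refine Finset.sum_le_sum fun t ht => ?_
    rw [quadForm_outer, hxy, real_inner_smul_right, mul_pow]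
    exact mul_le_mul_of_nonneg_right (hc2 t (Finset.mem_range.1 ht)) (sq_nonneg _)
  have h1 := sum_inner_costGrad_le hc hΩ hη ℓ m T (η' := η') (fun t ht => by
    rw [hxy, norm_smul, mul_pow, Real.norm_eq_abs, sq_abs]
    have : ‖ℓ t - m t‖ ^ 2 ≤ 1 := by nlinarith [norm_nonneg (ℓ t - m t), hy t ht]
    nlinarith [sq_nonneg ‖ℓ t - m t‖, hc2 t ht]) hu
  have h2 : quadForm (matSqrt (1 + (agState Ω η η' ℓ m T).gram)) u
      ≤ 3 / 2 * quadForm (matSqrt (1 + errGram ℓ m T)) u :=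
    quadForm_matSqrt_le_mul (Matrix.PosSemidef.one.add hG) (Matrix.PosSemidef.one.add hE)
      (by norm_num) (fun v => by
        rw [quadForm_add, quadForm_add, quadForm_one]
        have := hGE v
        have := sq_nonneg ‖v‖
        linarith) u
  have h3 : (matSqrt (1 + (agState Ω η η' ℓ m T).gram)).trace
      - (matSqrt (1 : Matrix (Fin d) (Fin d) ℝ)).trace
      ≤ 3 / 2 * (matSqrt (errGram ℓ m T)).trace := by
    have e1 := trace_le_of_quadForm_le (quadForm_matSqrt_one_add_le hG)
    have e2 := trace_le_of_quadForm_le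
      (A := matSqrt (agState Ω η η' ℓ m T).gram) (B := (3 / 2 : ℝ) • matSqrt (errGram ℓ m T))
      (fun v => by
        rw [quadForm_smul]
        exact quadForm_matSqrt_le_mul hG hE (by norm_num) (fun v => by
          have := hGE v; linarith) v)
    rw [Matrix.trace_add] at e1
    rw [Matrix.trace_smul, smul_eq_mul] at e2
    rw [matSqrt_one]; linarith
  have h4 := Finset.sum_le_sum fun t (_ : t ∈ Finset.range T) =>
    inner_sub_le_costGrad hη'.le (ℓ t) (m t) (adaGrad Ω η η' ℓ m t) u
  simp only [Finset.sum_sub_distrib, Finset.sum_add_distrib, ← Finset.mul_sum,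
    inner_sub_left _ u (costGrad _ _ _ _)] at h4
  rw [← inner_sum, ← agState_gradSum] at h4
  have h5 : quadForm (matSqrt (1 + (agState Ω η η' ℓ m T).gram)) u / (2 * η)
      ≤ 3 / 4 * (quadForm (matSqrt (1 + errGram ℓ m T)) u / η) := by
    rw [div_le_iff₀ (by positivity)]
    field_simp
    linarith
  have h6 := mul_le_mul_of_nonneg_left h3 (by positivity : 0 ≤ 2 * η)
  linarith

end AdaGrad

/-! ### The master algorithm -/

/-- The divergence `p log (p / q) - p + q` of two nonnegative numbers. -/
def klTerm (p q : ℝ) : ℝ := p * Real.log p - p * Real.log q - p + q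

theorem klTerm_self (p : ℝ) : klTerm p p = 0 := by unfold klTerm; ring

theorem klTerm_pos {p q : ℝ} (hp : 0 ≤ p) (hq : 0 < q) (hne : p ≠ q) : 0 < klTerm p q := by
  unfold klTerm
  rcases hp.eq_or_lt with rfl | hp
  · simpa using hq
  · have h := Real.log_lt_sub_one_of_pos (div_pos hq hp) (by
      rw [ne_eq, div_eq_one_iff_eq hp.ne']; exact hne.symm)
    rw [Real.log_div hq.ne' hp.ne'] at h
    have h2 := mul_lt_mul_of_pos_left h hp
    rw [mul_sub, mul_sub, mul_div_cancel₀ _ hp.ne'] at h2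
    linarith

theorem klTerm_nonneg {p q : ℝ} (hp : 0 ≤ p) (hq : 0 < q) : 0 ≤ klTerm p q := by
  rcases eq_or_ne p q with rfl | h
  · rw [klTerm_self]
  · exact (klTerm_pos hp hq h).le

/-- The local-norm stability bound: over all `q > 0`, `(p - q) a - klTerm q p` is largest at
`q = p e^{-a}`, where it equals `p (e^{-a} - 1 + a)`. -/
theorem sub_mul_sub_klTerm_le {p q a : ℝ} (hp : 0 < p) (hq : 0 < q) (ha : |a| ≤ 1) :
    (p - q) * a - klTerm q p ≤ p * a ^ 2 := by
  have h1 : Real.exp (-a) ≤ 1 - a + a ^ 2 := by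
    have h := Real.abs_exp_sub_one_sub_id_le (x := -a) (by rwa [abs_neg])
    rw [abs_le] at h
    nlinarith [h.2]
  have h2 := klTerm_nonneg hq.le (mul_pos hp (Real.exp_pos (-a)))
  rw [klTerm, Real.log_mul hp.ne' (Real.exp_pos _).ne', Real.log_exp] at h2
  have h3 := mul_le_mul_of_nonneg_left h1 hp.le
  unfold klTerm
  linarith

section Master

variable {d : ℕ} {ι : Type*} [Fintype ι]

/-- The Bregman divergence of the weighted negative entropy. -/
def entropyDiv (E : ι → Expert d) (p q : ι → ℝ) : ℝ :=
  ∑ k, (1 / (E k).rate) * klTerm (p k) (q k)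

theorem entropyDiv_nonneg {E : ι → Expert d} (hE : ∀ k, 0 < (E k).rate) {p q : ι → ℝ}
    (hp : ∀ k, 0 ≤ p k) (hq : ∀ k, 0 < q k) : 0 ≤ entropyDiv E p q :=
  Finset.sum_nonneg fun k _ =>
    mul_nonneg (one_div_pos.2 (hE k)).le (klTerm_nonneg (hp k) (hq k))

theorem entropyDiv_self (E : ι → Expert d) (p : ι → ℝ) : entropyDiv E p p = 0 := by
  simp [entropyDiv, klTerm_self]

theorem eq_of_entropyDiv_le_zero {E : ι → Expert d} (hE : ∀ k, 0 < (E k).rate) {p q : ι → ℝ}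
    (hp : ∀ k, 0 ≤ p k) (hq : ∀ k, 0 < q k) (h : entropyDiv E p q ≤ 0) : p = q := by
  have hnn : ∀ k ∈ Finset.univ, 0 ≤ (1 / (E k).rate) * klTerm (p k) (q k) := fun k _ =>
    mul_nonneg (one_div_pos.2 (hE k)).le (klTerm_nonneg (hp k) (hq k))
  have h0 := (Finset.sum_eq_zero_iff_of_nonneg hnn).1 (le_antisymm h (Finset.sum_nonneg hnn))
  funext k
  by_contra hne
  exact (mul_pos (one_div_pos.2 (hE k)) (klTerm_pos (hp k) (hq k) hne)).ne'
    (h0 k (Finset.mem_univ k))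

theorem bregman_entropyReg (E : ι → Expert d) (p : ι → ℝ) {q : ι → ℝ} (hq : ∀ k, 0 < q k) :
    bregman (entropyReg E) p q = entropyDiv E p q := by
  have h : HasFDerivAt (entropyReg E)
      (∑ k, (1 / (E k).rate) • ((Real.log (q k) + 1) •
        (ContinuousLinearMap.proj k : (ι → ℝ) →L[ℝ] ℝ))) q := by
    unfold entropyReg
    refine HasFDerivAt.fun_sum fun k _ => HasFDerivAt.const_mul ?_ _
    exact (Real.hasDerivAt_mul_log (hq k).ne').comp_hasFDerivAt q
      (ContinuousLinearMap.proj (R := ℝ) (φ := fun _ : ι => ℝ) k).hasFDerivAt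
  rw [bregman, h.fderiv, entropyReg, entropyReg, entropyDiv, sum_apply,
    ← Finset.sum_sub_distrib, ← Finset.sum_sub_distrib]
  refine Finset.sum_congr rfl fun k _ => ?_
  simp only [smul_apply, ContinuousLinearMap.proj_apply, Pi.sub_apply, smul_eq_mul, klTerm]
  ring

/-- The normalization of the multiplicative-weights update with individual rates. -/
theorem exists_sum_mul_exp_eq_one [Nonempty ι] {η p : ι → ℝ} (hη : ∀ k, 0 < η k)
    (hp : ∀ k, 0 < p k) (x : ι → ℝ) :
    ∃ c : ℝ, ∑ k, p k * Real.exp (-(η k * (x k + c))) = 1 := by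
  have hcont : Continuous fun c : ℝ => ∑ k, p k * Real.exp (-(η k * (x k + c))) := by fun_prop
  apply mem_range_of_exists_le_of_exists_ge hcont
  · have ht : Filter.Tendsto (fun c : ℝ => ∑ k, p k * Real.exp (-(η k * (x k + c))))
        Filter.atTop (nhds (∑ k : ι, p k * 0)) := by
      refine tendsto_finsetSum _ fun k _ => Filter.Tendsto.const_mul _ ?_
      refine Real.tendsto_exp_neg_atTop_nhds_zero.comp ?_
      exact (Filter.tendsto_atTop_add_const_left _ _ Filter.tendsto_id).const_mul_atTop (hη k)
    simp only [mul_zero, Finset.sum_const_zero] at ht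
    exact (ht.eventually (Iic_mem_nhds (zero_lt_one : (0 : ℝ) < 1))).exists
  · obtain ⟨k⟩ := ‹Nonempty ι›
    refine ⟨Real.log (p k) / η k - x k, ?_⟩
    refine le_trans ?_ (Finset.single_le_sum (f := fun j => p j * Real.exp (-(η j * (x j + _))))
      (fun j _ => mul_nonneg (hp j).le (Real.exp_pos _).le) (Finset.mem_univ k))
    simp only [add_sub_cancel]
    rw [mul_div_cancel₀ _ (hη k).ne', Real.exp_neg, Real.exp_log (hp k),
      mul_inv_cancel₀ (hp k).ne']

/-- A step from a positive center stays positive and satisfies the three-point identity. -/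
theorem masterStep_spec [Nonempty ι] {E : ι → Expert d} (hE : ∀ k, 0 < (E k).rate)
    {c : ι → ℝ} (hc : ∀ k, 0 < c k) (x : ι → ℝ) :
    (∀ k, 0 < masterStep E (stdSimplex ℝ ι) c x k) ∧
    masterStep E (stdSimplex ℝ ι) c x ∈ stdSimplex ℝ ι ∧
    ∀ v ∈ stdSimplex ℝ ι,
      ∑ k, masterStep E (stdSimplex ℝ ι) c x k * x k
          + entropyDiv E (masterStep E (stdSimplex ℝ ι) c x) c
          + entropyDiv E v (masterStep E (stdSimplex ℝ ι) c x)
        = ∑ k, v k * x k + entropyDiv E v c := by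
  obtain ⟨lam, hlam⟩ := exists_sum_mul_exp_eq_one hE hc x
  set q : ι → ℝ := fun k => c k * Real.exp (-((E k).rate * (x k + lam))) with hq
  have hqpos : ∀ k, 0 < q k := fun k => mul_pos (hc k) (Real.exp_pos _)
  have hqmem : q ∈ stdSimplex ℝ ι := ⟨fun k => (hqpos k).le, hlam⟩
  have hlog : ∀ k, Real.log (q k) = Real.log (c k) - (E k).rate * (x k + lam) := fun k => by
    rw [hq]; simp only
    rw [Real.log_mul (hc k).ne' (Real.exp_pos _).ne', Real.log_exp]; ring
  have hobj : ∀ v ∈ stdSimplex ℝ ι, ∑ k, v k * x k + entropyDiv E v c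
      = entropyDiv E v q - lam + ∑ k, (1 / (E k).rate) * (c k - q k) := by
    intro v hv
    have h1 : lam = ∑ k, lam * v k := by rw [← Finset.mul_sum, hv.2, mul_one]
    conv_rhs => rw [h1]
    rw [entropyDiv, entropyDiv, ← Finset.sum_add_distrib, ← Finset.sum_sub_distrib,
      ← Finset.sum_add_distrib]
    refine Finset.sum_congr rfl fun k _ => ?_
    rw [klTerm, klTerm, hlog]
    have := (hE k).ne'
    field_simp
    ring
  have hmin : ∀ v ∈ stdSimplex ℝ ι, ∑ k, v k * x k + entropyDiv E v c
      = ∑ k, q k * x k + entropyDiv E q c + entropyDiv E v q := by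
    intro v hv
    rw [hobj v hv, hobj q hqmem, entropyDiv_self]; ring
  have hspec : masterStep E (stdSimplex ℝ ι) c x ∈ stdSimplex ℝ ι ∧
      IsMinOn (fun p => ∑ k, p k * x k + bregman (entropyReg E) p c) (stdSimplex ℝ ι)
        (masterStep E (stdSimplex ℝ ι) c x) := by
    apply argminOn_spec
    refine ⟨q, hqmem, fun v hv => ?_⟩
    simp only [bregman_entropyReg E _ hc, Set.mem_ofPred_eq]
    rw [hmin v hv]
    linarith [entropyDiv_nonneg hE hv.1 hqpos]
  have heq : masterStep E (stdSimplex ℝ ι) c x = q := by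
    apply eq_of_entropyDiv_le_zero hE hspec.1.1 hqpos
    have := hspec.2 hqmem
    simp only [bregman_entropyReg E _ hc, Set.mem_ofPred_eq] at this
    rw [hmin _ hspec.1] at this
    linarith
  rw [heq]
  exact ⟨hqpos, hqmem, fun v hv => (hmin v hv).symm⟩

theorem masterCenter_pos [Nonempty ι] {E : ι → Expert d} (hE : ∀ k, 0 < (E k).rate)
    (ℓ m : ℕ → Vec d) (t : ℕ) (k : ι) :
    0 < masterCenter E (fun _ => stdSimplex ℝ ι) ℓ m t k := by
  induction t generalizing k with
  | zero =>
    exact div_pos (pow_pos (hE k) 2)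
      (Finset.sum_pos (fun j _ => pow_pos (hE j) 2) Finset.univ_nonempty)
  | succ t ih => exact (masterStep_spec hE ih _).1 k

theorem masterWeights_mem [Nonempty ι] {E : ι → Expert d} (hE : ∀ k, 0 < (E k).rate)
    (ℓ m : ℕ → Vec d) (t : ℕ) :
    masterWeights E (fun _ => stdSimplex ℝ ι) ℓ m t ∈ stdSimplex ℝ ι :=
  (masterStep_spec hE (masterCenter_pos hE ℓ m t) _).2.1

theorem master_mem [Nonempty ι] {E : ι → Expert d} (hE : ∀ k, 0 < (E k).rate)
    {K : Set (Vec d)} (hK : Convex ℝ K) {ℓ m : ℕ → Vec d} {t : ℕ}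
    (h : ∀ k, (E k).alg ℓ m t ∈ K) : master E (fun _ => stdSimplex ℝ ι) ℓ m t ∈ K := by
  have hp := masterWeights_mem hE ℓ m t
  exact hK.sum_mem (fun k _ => hp.1 k) hp.2 fun k _ => h k

/-- One round of the master. The correction terms `b` pay for the stability of the weights, so
that the comparator only suffers its own correction. -/
theorem master_round_le [Nonempty ι] {E : ι → Expert d} (hE : ∀ k, 0 < (E k).rate)
    (ℓ m : ℕ → Vec d) {t : ℕ}
    (hb : ∀ k, 32 * (E k).rate * |expertLoss E ℓ m t k - predLoss E ℓ m t k| ≤ 1 / 2)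
    {e : ι → ℝ} (he : e ∈ stdSimplex ℝ ι) :
    ∑ k, masterWeights E (fun _ => stdSimplex ℝ ι) ℓ m t k * expertLoss E ℓ m t k
        - ∑ k, e k * expertLoss E ℓ m t k
      ≤ ∑ k, e k * correction E ℓ m t k
        + entropyDiv E e (masterCenter E (fun _ => stdSimplex ℝ ι) ℓ m t)
        - entropyDiv E e (masterCenter E (fun _ => stdSimplex ℝ ι) ℓ m (t + 1)) := by
  have hcpos := masterCenter_pos hE ℓ m t
  obtain ⟨hPpos, hPmem, h1⟩ := masterStep_spec hE hcpos (predLoss E ℓ m t)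
  obtain ⟨hQpos, hQmem, h2⟩ := masterStep_spec hE hcpos
    (fun k => expertLoss E ℓ m t k + correction E ℓ m t k)
  have h1 := h1 _ hQmem
  have h2 := h2 _ he
  change _ ≤ _ + _ - entropyDiv E e (masterStep E (stdSimplex ℝ ι) _
    (fun k => expertLoss E ℓ m t k + correction E ℓ m t k))
  change ∑ k, masterStep E (stdSimplex ℝ ι) _ (predLoss E ℓ m t) k * _ - _ ≤ _
  set P := masterStep E (stdSimplex ℝ ι) (masterCenter E (fun _ => stdSimplex ℝ ι) ℓ m t)
    (predLoss E ℓ m t)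
  set Q := masterStep E (stdSimplex ℝ ι) (masterCenter E (fun _ => stdSimplex ℝ ι) ℓ m t)
    (fun k => expertLoss E ℓ m t k + correction E ℓ m t k)
  set c := masterCenter E (fun _ => stdSimplex ℝ ι) ℓ m t
  have h3 := entropyDiv_nonneg hE (fun k => (hPpos k).le) hcpos
  have hstab : ∑ k, (P k - Q k)
        * (expertLoss E ℓ m t k + correction E ℓ m t k - predLoss E ℓ m t k)
      - entropyDiv E Q P ≤ ∑ k, P k * correction E ℓ m t k := by
    rw [entropyDiv, ← Finset.sum_sub_distrib]
    refine Finset.sum_le_sum fun k _ => ?_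
    have hη := hE k
    have hbk := hb k
    set η := (E k).rate
    set y := expertLoss E ℓ m t k - predLoss E ℓ m t k with hy
    have hcorr : correction E ℓ m t k = 32 * η * y ^ 2 := rfl
    have hz : expertLoss E ℓ m t k + correction E ℓ m t k - predLoss E ℓ m t k
        = y * (1 + 32 * η * y) := by rw [hcorr, hy]; ring
    have habs : |32 * η * y| ≤ 1 / 2 := by
      rwa [abs_mul, abs_of_nonneg (by positivity : 0 ≤ 32 * η)]
    have hrange := abs_le.1 habs
    have hfac : (1 + 32 * η * y) ^ 2 ≤ 4 := by nlinarith [hrange.1, hrange.2]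
    have ha : |η * (y * (1 + 32 * η * y))| ≤ 1 := by
      rw [← sq_le_one_iff_abs_le_one]
      have e1 : (η * (y * (1 + 32 * η * y))) ^ 2
          = (32 * η * y) ^ 2 / 1024 * (1 + 32 * η * y) ^ 2 := by ring
      have e2 : (32 * η * y) ^ 2 ≤ 1 := by nlinarith [hrange.1, hrange.2]
      rw [e1]
      nlinarith [sq_nonneg (32 * η * y)]
    have h4 := sub_mul_sub_klTerm_le (hPpos k) (hQpos k) ha
    rw [hz, hcorr]
    have h5 : (P k - Q k) * (y * (1 + 32 * η * y)) - 1 / η * klTerm (Q k) (P k)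
        = ((P k - Q k) * (η * (y * (1 + 32 * η * y))) - klTerm (Q k) (P k)) / η := by
      field_simp
    rw [h5, div_le_iff₀ hη]
    refine h4.trans ?_
    have h6 : P k * (η * (y * (1 + 32 * η * y))) ^ 2
        = P k * (η * y) ^ 2 * (1 + 32 * η * y) ^ 2 := by ring
    rw [h6]
    have h7 : 0 ≤ P k * (η * y) ^ 2 := mul_nonneg (hPpos k).le (sq_nonneg _)
    nlinarith
  simp only [mul_add, mul_sub, sub_mul, Finset.sum_add_distrib, Finset.sum_sub_distrib]
    at h1 h2 hstab ⊢
  linarith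

/-- Regret of the master against a single expert. -/
theorem master_regret_le [Nonempty ι] {E : ι → Expert d} (hE : ∀ k, 0 < (E k).rate)
    (ℓ m : ℕ → Vec d) {T : ℕ}
    (hb : ∀ t < T, ∀ k, 32 * (E k).rate * |inner ℝ ((E k).alg ℓ m t) (ℓ t - m t)| ≤ 1 / 2)
    (k : ι) :
    ∑ t ∈ Finset.range T,
        inner ℝ (master E (fun _ => stdSimplex ℝ ι) ℓ m t - (E k).alg ℓ m t) (ℓ t)
      ≤ 32 * (E k).rate * ∑ t ∈ Finset.range T, inner ℝ ((E k).alg ℓ m t) (ℓ t - m t) ^ 2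
        + 1 / (E k).rate * Real.log ((∑ j, (E j).rate ^ 2) / (E k).rate ^ 2)
        + (∑ j, (E j).rate) / ∑ j, (E j).rate ^ 2 := by
  classical
  have he : Pi.single k (1 : ℝ) ∈ stdSimplex ℝ ι := single_mem_stdSimplex ℝ k
  have hround : ∀ t ∈ Finset.range T,
      inner ℝ (master E (fun _ => stdSimplex ℝ ι) ℓ m t - (E k).alg ℓ m t) (ℓ t)
      ≤ 32 * (E k).rate * inner ℝ ((E k).alg ℓ m t) (ℓ t - m t) ^ 2
        + (entropyDiv E (Pi.single k 1) (masterCenter E (fun _ => stdSimplex ℝ ι) ℓ m t)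
        - entropyDiv E (Pi.single k 1) (masterCenter E (fun _ => stdSimplex ℝ ι) ℓ m (t + 1))) := by
    intro t ht
    have h := master_round_le hE ℓ m (t := t) (fun j => by
      have := hb t (Finset.mem_range.1 ht) j
      rwa [inner_sub_right] at this) he
    simp only [Pi.single_apply, ite_mul, one_mul, zero_mul, Finset.sum_ite_eq',
      Finset.mem_univ, if_true] at h
    have h2 : inner ℝ (master E (fun _ => stdSimplex ℝ ι) ℓ m t) (ℓ t)
        = ∑ j, masterWeights E (fun _ => stdSimplex ℝ ι) ℓ m t j * expertLoss E ℓ m t j := by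
      simp only [master, sum_inner, real_inner_smul_left, expertLoss]
    rw [inner_sub_left, h2, inner_sub_right]
    have h3 : correction E ℓ m t k = 32 * (E k).rate *
      (inner ℝ ((E k).alg ℓ m t) (ℓ t) - inner ℝ ((E k).alg ℓ m t) (m t)) ^ 2 := rfl
    have h4 : expertLoss E ℓ m t k = inner ℝ ((E k).alg ℓ m t) (ℓ t) := rfl
    rw [h3, h4] at h
    linarith
  have hsum := Finset.sum_le_sum hround
  rw [Finset.sum_add_distrib, ← Finset.mul_sum, Finset.sum_range_sub'] at hsum
  have hT := entropyDiv_nonneg hE he.1 (masterCenter_pos hE ℓ m T)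
  have hS : 0 < ∑ j, (E j).rate ^ 2 :=
    Finset.sum_pos (fun j _ => pow_pos (hE j) 2) Finset.univ_nonempty
  have h0 : entropyDiv E (Pi.single k 1) (masterCenter E (fun _ => stdSimplex ℝ ι) ℓ m 0)
      ≤ 1 / (E k).rate * Real.log ((∑ j, (E j).rate ^ 2) / (E k).rate ^ 2)
        + (∑ j, (E j).rate) / ∑ j, (E j).rate ^ 2 := by
    have h1 : ∀ j, 1 / (E j).rate * klTerm ((Pi.single k 1 : ι → ℝ) j)
        (masterCenter E (fun _ => stdSimplex ℝ ι) ℓ m 0 j)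
        ≤ (if j = k then 1 / (E k).rate
            * Real.log ((∑ j, (E j).rate ^ 2) / (E k).rate ^ 2) else 0)
          + (E j).rate / ∑ j, (E j).rate ^ 2 := by
      intro j
      have hηj := hE j
      have hcent : 1 / (E j).rate * masterCenter E (fun _ => stdSimplex ℝ ι) ℓ m 0 j
          = (E j).rate / ∑ j, (E j).rate ^ 2 := by
        simp only [masterCenter]; field_simp
      rw [klTerm, mul_add, hcent]
      rcases eq_or_ne j k with rfl | hne
      · have hl : Real.log ((∑ i, (E i).rate ^ 2) / (E j).rate ^ 2)
            = -Real.log (masterCenter E (fun _ => stdSimplex ℝ ι) ℓ m 0 j) := by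
          rw [← Real.log_inv]; simp only [masterCenter]; rw [inv_div]
        rw [if_pos rfl, hl]
        simp only [Pi.single_eq_same, Real.log_one]
        have : 0 < 1 / (E j).rate := one_div_pos.2 hηj
        linarith
      · simp [hne]
    refine (Finset.sum_le_sum fun j _ => h1 j).trans (le_of_eq ?_)
    rw [Finset.sum_add_distrib, ← Finset.sum_div, Finset.sum_ite_eq' Finset.univ k,
      if_pos (Finset.mem_univ k)]
  linarith

end Master

/-! ### Dyadic grids -/

theorem le_two_zpow_clog2 {x : ℝ} (hx : 0 < x) : x ≤ (2 : ℝ) ^ clog2 x := by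
  rw [← Real.rpow_intCast, ← Real.logb_le_iff_le_rpow one_lt_two hx]
  exact Int.le_ceil _

theorem two_zpow_clog2_le {x : ℝ} (hx : 0 < x) : (2 : ℝ) ^ clog2 x ≤ 2 * x := by
  have h : ((clog2 x : ℤ) : ℝ) ≤ Real.logb 2 x + 1 := (Int.ceil_lt_add_one _).le
  rw [← Real.rpow_intCast]
  refine (Real.rpow_le_rpow_of_exponent_le one_le_two h).trans (le_of_eq ?_)
  rw [Real.rpow_add two_pos, Real.rpow_logb two_pos (by norm_num) hx, Real.rpow_one, mul_comm]

theorem clog2_le_of_le {x : ℝ} (hx : 0 < x) {j : ℤ} (h : x ≤ (2 : ℝ) ^ j) : clog2 x ≤ j := by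
  rw [← Real.rpow_intCast, ← Real.logb_le_iff_le_rpow one_lt_two hx] at h
  exact Int.ceil_le.2 h

theorem clog2_mono {x y : ℝ} (hx : 0 < x) (h : x ≤ y) : clog2 x ≤ clog2 y :=
  clog2_le_of_le hx (h.trans (le_two_zpow_clog2 (hx.trans_le h)))

theorem two_zpow_neg_clog2_le {x : ℝ} (hx : 0 < x) : (2 : ℝ) ^ (-clog2 x) ≤ 1 / x := by
  rw [zpow_neg, ← one_div]
  exact one_div_le_one_div_of_le hx (le_two_zpow_clog2 hx)

theorem one_le_clog2 {x : ℝ} (hx : 2 ≤ x) : 1 ≤ clog2 x := by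
  have h := le_two_zpow_clog2 (by linarith : 0 < x)
  have h2 : (2 : ℝ) ^ (1 : ℤ) ≤ (2 : ℝ) ^ clog2 x := by rw [zpow_one]; linarith
  exact (zpow_le_zpow_iff_right₀ one_lt_two).1 h2

/-- Every `x ≤ 2 ^ b` lies below a grid point that is at most `2 x` or is the lowest one; the sum
of the two covers both cases. -/
theorem exists_two_zpow_mem_Icc {a b : ℤ} (hab : a ≤ b) {x : ℝ} (hx : x ≤ (2 : ℝ) ^ b)
    (hx0 : 0 ≤ x) :
    ∃ j ∈ Finset.Icc a b, x ≤ (2 : ℝ) ^ j ∧ (2 : ℝ) ^ j ≤ 2 * x + (2 : ℝ) ^ a := by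
  have ha : (0 : ℝ) < (2 : ℝ) ^ a := by positivity
  rcases le_or_gt x ((2 : ℝ) ^ a) with h | h
  · exact ⟨a, Finset.mem_Icc.2 ⟨le_rfl, hab⟩, h, by linarith⟩
  · have hpos : 0 < x := ha.trans h
    have h1 := le_two_zpow_clog2 hpos
    refine ⟨clog2 x, Finset.mem_Icc.2 ⟨?_, clog2_le_of_le hpos hx⟩, h1,
      (two_zpow_clog2_le hpos).trans (by linarith)⟩
    exact ((zpow_lt_zpow_iff_right₀ one_lt_two).1 (h.trans_le h1)).le

theorem sum_Icc_two_zpow_neg_le (a b : ℤ) :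
    ∑ j ∈ Finset.Icc a b, (2 : ℝ) ^ (-j) ≤ 2 * (2 : ℝ) ^ (-a) := by
  rcases lt_or_ge b a with h | h
  · rw [Finset.Icc_eq_empty (by omega), Finset.sum_empty]; positivity
  · have key : ∑ j ∈ Finset.Icc a b, (2 : ℝ) ^ (-j) = 2 * (2 : ℝ) ^ (-a) - (2 : ℝ) ^ (-b) := by
      induction b, h using Int.leInduction with
      | base => simp; ring
      | succ b hb ih =>
        have : Finset.Icc a (b + 1) = insert (b + 1) (Finset.Icc a b) := by
          ext j; simp only [Finset.mem_Icc, Finset.mem_insert]; omega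
        rw [this, Finset.sum_insert (by simp), ih, neg_add, zpow_add₀ two_ne_zero]
        norm_num; ring
    rw [key]
    have : (0 : ℝ) < (2 : ℝ) ^ (-b) := by positivity
    linarith

/-! ### The experts of the union -/

section Union

variable {d : ℕ}

theorem isCompact_cut {K : Set (Vec d)} (hK : IsCompact K) (j : ℤ) : IsCompact (cut K j) :=
  hK.inter_right (isClosed_le continuous_norm continuous_const)

theorem convex_cut {K : Set (Vec d)} (hK : Convex ℝ K) (j : ℤ) : Convex ℝ (cut K j) := by
  have h : {w : Vec d | ‖w‖ ≤ (2 : ℝ) ^ j} = Metric.closedBall 0 ((2 : ℝ) ^ j) :=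
    Set.ext fun w => mem_closedBall_zero_iff.symm
  rw [cut, h]
  exact hK.inter (convex_closedBall _ _)

theorem zero_mem_cut {K : Set (Vec d)} (hK : (0 : Vec d) ∈ K) (j : ℤ) : (0 : Vec d) ∈ cut K j :=
  ⟨hK, by simp only [Set.mem_ofPred_eq, norm_zero]; positivity⟩

theorem rate_eq (c : ℝ) (i j : ℤ) :
    1 / (c * (2 : ℝ) ^ (i + j)) = 1 / c * (2 : ℝ) ^ (-i) * (2 : ℝ) ^ (-j) := by
  rw [zpow_add₀ two_ne_zero, zpow_neg, zpow_neg]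
  field_simp

theorem unionExpert_rate_pos (K : Set (Vec d)) (T : ℕ) (D : ℝ) (k : UnionIndex d T D) :
    0 < (unionExpert K T D k).rate := by
  rcases k with k | k | k <;>
    simp only [unionExpert, onsExpert, gdExpert, agExpert, onsRate, gdRate, agRate] <;> positivity

theorem rate_mul_norm_le {c : ℝ} (hc : 0 < c) {i j : ℤ} (hj : 1 ≤ j) {w : Vec d}
    (hw : ‖w‖ ≤ (2 : ℝ) ^ i) : 1 / (c * (2 : ℝ) ^ (i + j)) * ‖w‖ ≤ 1 / (2 * c) := by
  have hi : (0 : ℝ) < (2 : ℝ) ^ i := by positivity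
  have h2 : (2 : ℝ) ≤ (2 : ℝ) ^ j := by
    calc (2 : ℝ) = (2 : ℝ) ^ (1 : ℤ) := (zpow_one _).symm
      _ ≤ _ := zpow_le_zpow_right₀ one_le_two hj
  rw [zpow_add₀ two_ne_zero, div_mul_eq_mul_div, one_mul, div_le_div_iff₀ (by positivity)
    (by positivity)]
  have h3 : (2 : ℝ) ^ i * 2 ≤ (2 : ℝ) ^ i * (2 : ℝ) ^ j := mul_le_mul_of_nonneg_left h2 hi.le
  have h4 := mul_le_mul_of_nonneg_left hw hc.le
  have h5 := mul_le_mul_of_nonneg_left h3 hc.le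
  linarith

/-- Every expert plays in `K`, within the radius that its learning rate tolerates. -/
theorem unionExpert_mem {K : Set (Vec d)} (hc : IsCompact K) (hK : Convex ℝ K)
    (h0 : (0 : Vec d) ∈ K) {T : ℕ} {D : ℝ} (ℓ m : ℕ → Vec d) (t : ℕ) (k : UnionIndex d T D) :
    (unionExpert K T D k).alg ℓ m t ∈ K ∧
      32 * (unionExpert K T D k).rate * ‖(unionExpert K T D k).alg ℓ m t‖ ≤ 1 / 2 := by
  rcases k with ⟨k, hk⟩ | ⟨k, hk⟩ | ⟨k, hk⟩ <;>
    simp only [unionExpert, onsExpert, gdExpert, agExpert, onsRate, gdRate, agRate]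
  · simp only [onsIndex, Finset.mem_product, Finset.mem_Icc] at hk
    have h := ons_mem (isCompact_cut hc k.1) ⟨0, zero_mem_cut h0 k.1⟩ (convex_cut hK k.1)
      (by positivity : 0 < 3 * (1 / (64 * (2 : ℝ) ^ (k.1 + k.2)))) ℓ m t
    refine ⟨h.1, ?_⟩
    have := rate_mul_norm_le (by norm_num : (0 : ℝ) < 64) hk.2.1 h.2
    linarith
  · simp only [gdIndex, Finset.mem_product, Finset.mem_Icc] at hk
    have h := optGD_mem (isCompact_cut hc k.1) ⟨0, zero_mem_cut h0 k.1⟩ (convex_cut hK k.1)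
      (by positivity : 0 < (4 : ℝ) ^ k.1 * (1 / (32 * (2 : ℝ) ^ (k.1 + k.2)))) ℓ m t
    refine ⟨h.1, ?_⟩
    have := rate_mul_norm_le (by norm_num : (0 : ℝ) < 32) hk.2.1 h.2
    linarith
  · simp only [agIndex, Finset.mem_product, Finset.mem_Icc] at hk
    have h := adaGrad_mem (isCompact_cut hc k.1) ⟨0, zero_mem_cut h0 k.1⟩ (convex_cut hK k.1)
      (by positivity : 0 < (2 : ℝ) ^ (k.2.2 + 1) * (1 / (64 * (2 : ℝ) ^ (k.1 + k.2.1))))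
      (2 * (1 / (64 * (2 : ℝ) ^ (k.1 + k.2.1)))) ℓ m t
    refine ⟨h.1, ?_⟩
    have := rate_mul_norm_le (by norm_num : (0 : ℝ) < 64) hk.2.1.1 h.2
    linarith

/-! ### The cost of the master -/

/-- Elementary consequences of `2 ≤ T` and `1 ≤ d T D` for `X = d T (1 + D)`. -/
theorem param_bounds {T : ℕ} {D : ℝ} (hT : 2 ≤ T) (hD : 1 ≤ (d : ℝ) * T * D) :
    0 < D ∧ 1 ≤ (d : ℝ) ∧ 2 ≤ (T : ℝ) ∧ (T : ℝ) ≤ (d : ℝ) * T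
      ∧ (d : ℝ) * T + 1 ≤ (d : ℝ) * T * (1 + D) ∧ (d : ℝ) * T * D ≤ (d : ℝ) * T * (1 + D)
      ∧ 1 ≤ Real.log ((d : ℝ) * T * (1 + D)) := by
  have hT' : (2 : ℝ) ≤ T := by exact_mod_cast hT
  have hd : 1 ≤ d := by
    by_contra h
    have : d = 0 := by omega
    subst this; norm_num at hD
  have hd' : (1 : ℝ) ≤ d := by exact_mod_cast hd
  have hTd : (T : ℝ) ≤ (d : ℝ) * T := le_mul_of_one_le_left (by linarith) hd'
  have hD0 : 0 < D := pos_of_mul_pos_right (lt_of_lt_of_le one_pos hD) (by positivity)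
  have hX : (d : ℝ) * T * (1 + D) = d * T + d * T * D := by ring
  refine ⟨hD0, hd', hT', hTd, by linarith, by linarith, ?_⟩
  rw [Real.le_log_iff_exp_le (by rw [hX]; linarith), hX]
  linarith [Real.exp_one_lt_d9]

theorem sum_rate_le {a b c e : ℤ} {κ : ℝ} (hκ : 0 ≤ κ) (hc : 1 ≤ c) :
    ∑ i ∈ Finset.Icc a b, ∑ j ∈ Finset.Icc c e, κ * (2 : ℝ) ^ (-i) * (2 : ℝ) ^ (-j)
      ≤ 2 * κ * (2 : ℝ) ^ (-a) := by
  have h1 := sum_Icc_two_zpow_neg_le a b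
  have h2 : ∑ j ∈ Finset.Icc c e, (2 : ℝ) ^ (-j) ≤ 1 := by
    refine (sum_Icc_two_zpow_neg_le c e).trans ?_
    have h : (2 : ℝ) ^ (-c) ≤ (2 : ℝ) ^ (-1 : ℤ) := zpow_le_zpow_right₀ one_le_two (by omega)
    rw [zpow_neg_one] at h
    linarith
  have h3 : (0 : ℝ) ≤ ∑ i ∈ Finset.Icc a b, (2 : ℝ) ^ (-i) :=
    Finset.sum_nonneg fun i _ => by positivity
  simp only [mul_assoc, ← Finset.mul_sum, ← Finset.sum_mul]
  have h4 := mul_le_mul_of_nonneg_left h2 h3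
  rw [mul_one] at h4
  have h5 := mul_le_mul_of_nonneg_left (h4.trans h1) hκ
  linarith

theorem card_scale_le {T : ℕ} {D : ℝ} (hT : 2 ≤ T) (hD : 1 ≤ (d : ℝ) * T * D) :
    ((Finset.Icc (-clog2 T) (clog2 (2 * D ^ 2 * T))).card : ℝ)
      ≤ 7 * Real.log ((d : ℝ) * T * (1 + D)) := by
  obtain ⟨hD0, hd, hT', hTd, hX1, hX2, hL⟩ := param_bounds hT hD
  have hcard : ((Finset.Icc (-clog2 T) (clog2 (2 * D ^ 2 * T))).card : ℝ)
      ≤ max 0 ((clog2 (2 * D ^ 2 * T) : ℝ) + clog2 T + 1) := by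
    rw [Int.card_Icc, ← Int.cast_natCast, Int.toNat_eq_max]
    push_cast
    rw [max_comm]
    apply max_le_max le_rfl (le_of_eq (by ring))
  refine hcard.trans (max_le (by linarith) ?_)
  have h1 : (clog2 (2 * D ^ 2 * T) : ℝ) ≤ Real.logb 2 (2 * D ^ 2 * T) + 1 :=
    (Int.ceil_lt_add_one _).le
  have h2 : (clog2 (T : ℝ) : ℝ) ≤ Real.logb 2 T + 1 := (Int.ceil_lt_add_one _).le
  have h3 : Real.logb 2 (2 * D ^ 2 * T) + Real.logb 2 T = 1 + 2 * Real.logb 2 (T * D) := by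
    rw [← Real.logb_mul (by positivity) (by positivity),
      show 2 * D ^ 2 * T * T = 2 * (T * D) ^ 2 by ring,
      Real.logb_mul (by positivity) (by positivity), Real.logb_pow, Real.logb_self_eq_one one_lt_two]
    norm_num
  have h4 : Real.logb 2 (T * D) ≤ Real.logb 2 ((d : ℝ) * T * (1 + D)) := by
    apply Real.logb_le_logb_of_le one_lt_two (by positivity)
    refine le_trans ?_ hX2
    exact mul_le_mul_of_nonneg_right hTd hD0.le
  have h5 : Real.logb 2 ((d : ℝ) * T * (1 + D)) ≤ 3 / 2 * Real.log ((d : ℝ) * T * (1 + D)) := by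
    rw [Real.logb, div_le_iff₀ (Real.log_pos one_lt_two)]
    nlinarith [Real.log_two_gt_d9]
  linarith

theorem sum_unionExpert_rate_le (K : Set (Vec d)) {T : ℕ} {D : ℝ} (hT : 2 ≤ T)
    (hD : 1 ≤ (d : ℝ) * T * D) :
    ∑ k, (unionExpert K T D k).rate
      ≤ (2 : ℝ) ^ clog2 ((d : ℝ) * T) * Real.log ((d : ℝ) * T * (1 + D)) := by
  obtain ⟨hD0, hd, hT', hTd, hX1, hX2, hL⟩ := param_bounds hT hD
  have hcard := card_scale_le hT hD
  set L := Real.log ((d : ℝ) * T * (1 + D))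
  set M := (2 : ℝ) ^ clog2 ((d : ℝ) * T) with hM
  have hM0 : 0 < M := by positivity
  have hMT : (2 : ℝ) ^ clog2 (T : ℝ) ≤ M :=
    zpow_le_zpow_right₀ one_le_two (clog2_mono (by linarith) hTd)
  rw [Fintype.sum_sum_type, Fintype.sum_sum_type]
  have h1 : ∑ k : onsIndex d T D, (unionExpert K T D (.inl k)).rate ≤ 2 * (1 / 64) * M := by
    simp only [unionExpert, onsExpert, onsRate]
    rw [Finset.sum_coe_sort (onsIndex d T D) fun k : ℤ × ℤ => 1 / (64 * (2 : ℝ) ^ (k.1 + k.2)),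
      onsIndex, Finset.sum_product]
    simp only [rate_eq]
    refine (sum_rate_le (by norm_num) le_rfl).trans (le_of_eq ?_)
    rw [neg_neg]
  have h2 : ∑ k : gdIndex T D, (unionExpert K T D (.inr (.inl k))).rate ≤ 2 * (1 / 32) * M := by
    simp only [unionExpert, gdExpert, gdRate]
    rw [Finset.sum_coe_sort (gdIndex T D) fun k : ℤ × ℤ => 1 / (32 * (2 : ℝ) ^ (k.1 + k.2)),
      gdIndex, Finset.sum_product]
    simp only [rate_eq]
    refine (sum_rate_le (by norm_num) le_rfl).trans ?_
    rw [neg_neg]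
    linarith
  have h3 : ∑ k : agIndex d T D, (unionExpert K T D (.inr (.inr k))).rate
      ≤ 7 * L * (2 * (1 / 64) * M) := by
    simp only [unionExpert, agExpert, agRate]
    rw [Finset.sum_coe_sort (agIndex d T D)
      fun k : ℤ × ℤ × ℤ => 1 / (64 * (2 : ℝ) ^ (k.1 + k.2.1)), agIndex, Finset.sum_product]
    simp only [Finset.sum_product, Finset.sum_const, nsmul_eq_mul, rate_eq]
    simp_rw [← Finset.mul_sum _ _ ((Finset.Icc (-clog2 (T : ℝ)) (clog2 (2 * D ^ 2 * T))).card : ℝ)]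
    have h4 := (sum_rate_le (by norm_num : (0 : ℝ) ≤ 1 / 64) (le_refl 1) (a := -clog2 T)
      (b := clog2 D) (e := clog2 ((d : ℝ) * T)))
    rw [neg_neg] at h4
    have h5 : 2 * (1 / 64) * (2 : ℝ) ^ clog2 (T : ℝ) ≤ 2 * (1 / 64) * M := by linarith
    exact mul_le_mul hcard (h4.trans h5)
      (Finset.sum_nonneg fun i _ => Finset.sum_nonneg fun j _ => by positivity) (by linarith)
  have h4 : M * 1 ≤ M * L := mul_le_mul_of_nonneg_left hL hM0.le
  linarith

theorem one_div_unionExpert_rate_le (K : Set (Vec d)) {T : ℕ} {D : ℝ} (hT : 2 ≤ T)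
    (hD : 1 ≤ (d : ℝ) * T * D) (k : UnionIndex d T D) :
    1 / (unionExpert K T D k).rate ≤ 256 * ((d : ℝ) * T * (1 + D)) := by
  obtain ⟨hD0, hd, hT', hTd, hX1, hX2, hL⟩ := param_bounds hT hD
  have key : ∀ {c : ℝ}, 0 < c → c ≤ 64 → ∀ {i j : ℤ}, i ≤ clog2 D → j ≤ clog2 ((d : ℝ) * T) →
      1 / (1 / (c * (2 : ℝ) ^ (i + j))) ≤ 256 * ((d : ℝ) * T * (1 + D)) := by
    intro c hc hc64 i j hi hj
    rw [one_div_one_div, zpow_add₀ two_ne_zero]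
    have h1 : (2 : ℝ) ^ i ≤ 2 * D :=
      (zpow_le_zpow_right₀ one_le_two hi).trans (two_zpow_clog2_le hD0)
    have h2 : (2 : ℝ) ^ j ≤ 2 * (d * T) :=
      (zpow_le_zpow_right₀ one_le_two hj).trans (two_zpow_clog2_le (by linarith))
    have h3 := mul_le_mul h1 h2 (by positivity) (by positivity)
    have h4 := mul_le_mul hc64 h3 (by positivity) (by positivity)
    refine h4.trans ?_
    linarith
  have hTdT : clog2 (T : ℝ) ≤ clog2 ((d : ℝ) * T) := clog2_mono (by linarith) hTd
  rcases k with ⟨k, hk⟩ | ⟨k, hk⟩ | ⟨k, hk⟩ <;>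
    simp only [unionExpert, onsExpert, gdExpert, agExpert, onsRate, gdRate, agRate]
  · simp only [onsIndex, Finset.mem_product, Finset.mem_Icc] at hk
    exact key (by norm_num) (by norm_num) hk.1.2 (hk.2.2.trans hTdT)
  · simp only [gdIndex, Finset.mem_product, Finset.mem_Icc] at hk
    exact key (by norm_num) (by norm_num) hk.1.2 (hk.2.2.trans hTdT)
  · simp only [agIndex, Finset.mem_product, Finset.mem_Icc] at hk
    exact key (by norm_num) (by norm_num) hk.1.2 hk.2.1.2

theorem neg_clog2_le_clog2 {x y : ℝ} (hx : 0 < x) (hy : 0 < y) (h : 1 ≤ x * y) :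
    -clog2 x ≤ clog2 y := by
  apply (zpow_le_zpow_iff_right₀ (one_lt_two : (1 : ℝ) < 2)).1
  refine (two_zpow_neg_clog2_le hx).trans (le_trans ?_ (le_two_zpow_clog2 hy))
  rw [div_le_iff₀ hx]; linarith

/-- The total cost of the prior is logarithmic: the sum of the learning rates is at most `M L` and
the largest of them is `M / 128`, where `M` is the power of two above `d T`. -/
theorem master_prior_cost_le (K : Set (Vec d)) {T : ℕ} {D : ℝ} (hT : 2 ≤ T)
    (hD : 1 ≤ (d : ℝ) * T * D) (k : UnionIndex d T D) :
    1 / (unionExpert K T D k).rate * Real.log ((∑ j, (unionExpert K T D j).rate ^ 2)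
        / (unionExpert K T D k).rate ^ 2)
      + (∑ j, (unionExpert K T D j).rate) / ∑ j, (unionExpert K T D j).rate ^ 2
    ≤ 19 * Real.log ((d : ℝ) * T * (1 + D)) / (unionExpert K T D k).rate
      + 16384 * Real.log ((d : ℝ) * T * (1 + D)) := by
  obtain ⟨hD0, hd, hT', hTd, hX1, hX2, hL⟩ := param_bounds hT hD
  have hS1 := sum_unionExpert_rate_le K hT hD
  have hrate := one_div_unionExpert_rate_le K hT hD k
  have hpos := unionExpert_rate_pos K T D
  have hM1 : 1 ≤ (2 : ℝ) ^ clog2 ((d : ℝ) * T) :=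
    le_trans (by linarith) (le_two_zpow_clog2 (by linarith : 0 < (d : ℝ) * T))
  have hM2 := two_zpow_clog2_le (by linarith : 0 < (d : ℝ) * T)
  have hmax : (((2 : ℝ) ^ clog2 ((d : ℝ) * T)) / 128) ^ 2
      ≤ ∑ j, (unionExpert K T D j).rate ^ 2 := by
    have hmem : (-clog2 ((d : ℝ) * T), (1 : ℤ)) ∈ onsIndex d T D := by
      simp only [onsIndex, Finset.mem_product, Finset.mem_Icc]
      exact ⟨⟨le_rfl, neg_clog2_le_clog2 (by linarith) hD0 hD⟩, le_rfl, one_le_clog2 hT'⟩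
    refine le_trans (le_of_eq ?_) (Finset.single_le_sum
      (f := fun j => (unionExpert K T D j).rate ^ 2) (fun j _ => sq_nonneg _)
      (Finset.mem_univ (Sum.inl ⟨_, hmem⟩)))
    simp only [unionExpert, onsExpert, onsRate, rate_eq, neg_neg]
    norm_num; ring
  have hS2 : ∑ j, (unionExpert K T D j).rate ^ 2 ≤ (∑ j, (unionExpert K T D j).rate) ^ 2 :=
    Finset.sum_sq_le_sq_sum_of_nonneg fun j _ => (hpos j).le
  have hηk := hpos k
  have hS1nn : 0 ≤ ∑ j, (unionExpert K T D j).rate := Finset.sum_nonneg fun j _ => (hpos j).le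
  set η := (unionExpert K T D k).rate
  set S1 := ∑ j, (unionExpert K T D j).rate
  set S2 := ∑ j, (unionExpert K T D j).rate ^ 2
  set M := (2 : ℝ) ^ clog2 ((d : ℝ) * T)
  set X := (d : ℝ) * T * (1 + D)
  set L := Real.log X
  clear_value η S1 S2 M X
  have hX0 : 0 < X := by linarith
  have hLX : L ≤ X := (Real.log_le_sub_one_of_pos hX0).trans (by linarith)
  have hS2pos : 0 < S2 := lt_of_lt_of_le (by positivity) hmax
  have hratio : S1 / S2 ≤ 16384 * L := by
    rw [div_le_iff₀ hS2pos]
    have h1 : M * L ≤ M * (M * L) := by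
      have : 0 ≤ M * L := by positivity
      nlinarith
    have h2 := mul_le_mul_of_nonneg_left hmax (by linarith : 0 ≤ 16384 * L)
    have h3 : 16384 * L * (M / 128) ^ 2 = M * (M * L) := by ring
    linarith
  -- `S2 ≤ 4 X⁴` and `1 / η² ≤ (256 X)²`, so the logarithm is at most `18 log 2 + 6 L`.
  have hlog : Real.log (S2 / η ^ 2) ≤ 19 * L := by
    have h1 : S1 ≤ 2 * X * X :=
      hS1.trans (mul_le_mul (by linarith) hLX (by linarith) (by linarith))
    have h2 : S2 ≤ (2 * X * X) ^ 2 := hS2.trans (pow_le_pow_left₀ hS1nn h1 2)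
    have h3 : (1 / η) ^ 2 ≤ (256 * X) ^ 2 := pow_le_pow_left₀ (by positivity) hrate 2
    have h4 : S2 / η ^ 2 ≤ 2 ^ 18 * X ^ 6 := by
      have : S2 / η ^ 2 = S2 * (1 / η) ^ 2 := by rw [one_div, inv_pow, div_eq_mul_inv]
      rw [this]
      refine (mul_le_mul h2 h3 (by positivity) (by positivity)).trans (le_of_eq (by ring))
    refine (Real.log_le_log (by positivity) h4).trans ?_
    rw [Real.log_mul (by positivity) (by positivity), Real.log_pow, Real.log_pow,
      Nat.cast_ofNat, Nat.cast_ofNat]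
    have h5 := Real.log_two_lt_d9
    have h6 : Real.log X = L := rfl
    rw [h6]
    linarith
  have h5 := mul_le_mul_of_nonneg_left hlog (one_div_pos.2 hηk).le
  have h6 : 1 / η * (19 * L) = 19 * L / η := by ring
  linarith

/-- Combining a regret bound of one expert with the regret of the master against it. -/
theorem bestOfThree_regret_le {K : Set (Vec d)} (hc : IsCompact K) (hK : Convex ℝ K)
    (h0 : (0 : Vec d) ∈ K) {T : ℕ} {D : ℝ} (hT : 2 ≤ T) (hD : 1 ≤ (d : ℝ) * T * D)
    {ℓ m : ℕ → Vec d} (hy : ∀ t < T, ‖ℓ t - m t‖ ≤ 1) (k : UnionIndex d T D) (u : Vec d) :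
    regret (bestOfThree K T D ℓ m) ℓ T u
      ≤ ∑ t ∈ Finset.range T, inner ℝ ((unionExpert K T D k).alg ℓ m t - u) (ℓ t)
        + 32 * (unionExpert K T D k).rate
          * ∑ t ∈ Finset.range T, inner ℝ ((unionExpert K T D k).alg ℓ m t) (ℓ t - m t) ^ 2
        + 19 * Real.log ((d : ℝ) * T * (1 + D)) / (unionExpert K T D k).rate
        + 16384 * Real.log ((d : ℝ) * T * (1 + D)) := by
  have : Nonempty (UnionIndex d T D) := ⟨k⟩
  have hpos := unionExpert_rate_pos K T D
  have h1 := master_regret_le hpos ℓ m (T := T) (fun t ht j => by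
    refine le_trans ?_ (unionExpert_mem hc hK h0 ℓ m t j).2
    refine mul_le_mul_of_nonneg_left ?_ (mul_nonneg (by norm_num) (hpos j).le)
    exact (abs_real_inner_le_norm _ _).trans
      (mul_le_of_le_one_right (norm_nonneg _) (hy t ht))) k
  have h2 := master_prior_cost_le K hT hD k
  have h3 : regret (bestOfThree K T D ℓ m) ℓ T u
      = ∑ t ∈ Finset.range T, inner ℝ (bestOfThree K T D ℓ m t
          - (unionExpert K T D k).alg ℓ m t) (ℓ t)
        + ∑ t ∈ Finset.range T, inner ℝ ((unionExpert K T D k).alg ℓ m t - u) (ℓ t) := by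
    rw [regret, ← Finset.sum_add_distrib]
    refine Finset.sum_congr rfl fun t _ => ?_
    rw [← inner_add_left, sub_add_sub_cancel]
  rw [h3]
  unfold bestOfThree
  linarith

end Union

/-! ### Tuning the three families of experts -/

section Tuning

variable {d : ℕ}

theorem sum_inner_sq_le {ℓ m : ℕ → Vec d} {T : ℕ} (hy : ∀ t < T, ‖ℓ t - m t‖ ≤ 1) (u : Vec d) :
    ∑ t ∈ Finset.range T, inner ℝ u (ℓ t - m t) ^ 2 ≤ T * ‖u‖ ^ 2 := by
  have h : ∀ t ∈ Finset.range T, inner ℝ u (ℓ t - m t) ^ 2 ≤ ‖u‖ ^ 2 := by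
    intro t ht
    rw [← sq_abs]
    refine pow_le_pow_left₀ (abs_nonneg _) ((abs_real_inner_le_norm _ _).trans ?_) 2
    exact mul_le_of_le_one_right (norm_nonneg _) (hy t (Finset.mem_range.1 ht))
  refine (Finset.sum_le_sum h).trans (le_of_eq ?_)
  simp

theorem sum_norm_sq_le {ℓ m : ℕ → Vec d} {T : ℕ} (hy : ∀ t < T, ‖ℓ t - m t‖ ≤ 1) :
    ∑ t ∈ Finset.range T, ‖ℓ t - m t‖ ^ 2 ≤ T := by
  have h : ∀ t ∈ Finset.range T, ‖ℓ t - m t‖ ^ 2 ≤ 1 := fun t ht =>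
    pow_le_one₀ (norm_nonneg _) (hy t (Finset.mem_range.1 ht))
  refine (Finset.sum_le_sum h).trans (le_of_eq ?_)
  simp

/-- The bound of the Online Newton Step experts, for the scale `2 ^ j ≈ ‖u‖` and the learning rate
`η ≈ √(r / ∑ ⟨u, ℓ - m⟩²)`. -/
theorem regret_le_of_onsExpert {K : Set (Vec d)} (hc : IsCompact K) (hK : Convex ℝ K)
    (h0 : (0 : Vec d) ∈ K) {T : ℕ} {D : ℝ} (hKD : ∀ w ∈ K, ‖w‖ ≤ D) (hT : 2 ≤ T)
    (hD : 1 ≤ (d : ℝ) * T * D)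
    {ℓ m : ℕ → Vec d} (hy : ∀ t < T, ‖ℓ t - m t‖ ≤ 1) {u : Vec d} (hu : u ∈ K) :
    regret (bestOfThree K T D ℓ m) ℓ T u
      ≤ 20000 * Real.log ((d : ℝ) * T * (1 + D)) *
        (1 + max ((errGram ℓ m T).rank : ℝ) 1 * ‖u‖
          + √(max ((errGram ℓ m T).rank : ℝ) 1
            * ∑ t ∈ Finset.range T, inner ℝ u (ℓ t - m t) ^ 2)) := by
  obtain ⟨hD0, hd, hT', hTd, hX1, hX2, hL⟩ := param_bounds hT hD
  have hdT : 0 < (d : ℝ) * T := by linarith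
  obtain ⟨j, hj, huj, hju⟩ := exists_two_zpow_mem_Icc (neg_clog2_le_clog2 hdT hD0 hD)
    ((hKD u hu).trans (le_two_zpow_clog2 hD0)) (norm_nonneg u)
  have hlow := two_zpow_neg_clog2_le hdT
  have hQ := sum_inner_sq_le hy u
  have hQ0 : 0 ≤ ∑ t ∈ Finset.range T, inner ℝ u (ℓ t - m t) ^ 2 :=
    Finset.sum_nonneg fun t _ => sq_nonneg _
  set Q := ∑ t ∈ Finset.range T, inner ℝ u (ℓ t - m t) ^ 2 with hQdef
  set R := max ((errGram ℓ m T).rank : ℝ) 1 with hR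
  have hR1 : 1 ≤ R := le_max_right _ _
  have hrR : ((errGram ℓ m T).rank : ℝ) ≤ R := le_max_left _ _
  have hRT : R ≤ T := max_le (by exact_mod_cast rank_errGram_le ℓ m T) (by linarith)
  have hJ : (0 : ℝ) < (2 : ℝ) ^ j := by positivity
  have hσ0 : 0 ≤ √(Q / R) := Real.sqrt_nonneg _
  have hσ2 : √(Q / R) ^ 2 * R = Q := by
    rw [Real.sq_sqrt (by positivity)]; field_simp
  -- The ideal `2 ^ s` is `√(Q / R) / 2 ^ j`, which balances `R / η` against `η Q`; it is at most
  -- `T` and so never exceeds the top of the grid.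
  have hσT : √(Q / R) ≤ T * (2 : ℝ) ^ j := by
    rw [Real.sqrt_le_iff]
    refine ⟨by positivity, (div_le_self hQ0 hR1).trans (hQ.trans ?_)⟩
    rw [mul_pow]
    exact mul_le_mul (by nlinarith) (pow_le_pow_left₀ (norm_nonneg _) huj 2) (by positivity)
      (by positivity)
  obtain ⟨s, hs, hs1, hs2⟩ := exists_two_zpow_mem_Icc (one_le_clog2 hT')
    (x := √(Q / R) / (2 : ℝ) ^ j)
    (((div_le_iff₀ hJ).2 hσT).trans (le_two_zpow_clog2 (by linarith)))
    (by positivity)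
  have hk : (j, s) ∈ onsIndex d T D := Finset.mem_product.2 ⟨hj, hs⟩
  have hs' : 1 ≤ s := (Finset.mem_Icc.1 hs).1
  have hmain := bestOfThree_regret_le hc hK h0 hT hD hy (.inl ⟨_, hk⟩) u
  simp only [unionExpert, onsExpert] at hmain
  have hηpos : 0 < onsRate (j, s) := by unfold onsRate; positivity
  have hrate := ons_regret_le (isCompact_cut hc j) (convex_cut hK j)
    (by positivity : 0 < 3 * onsRate (j, s)) (fun w hw => by
      have h1 := rate_mul_norm_le (by norm_num : (0 : ℝ) < 64) hs' hw.2
      change 32 * (3 * (1 / (64 * (2 : ℝ) ^ (j + s)))) * ‖w‖ ≤ 3 / 4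
      linarith) ℓ m (u := u) ⟨hu, huj⟩ hy
  have hηW : onsRate (j, s) * (64 * ((2 : ℝ) ^ j * (2 : ℝ) ^ s)) = 1 := by
    rw [onsRate, ← zpow_add₀ two_ne_zero]
    exact one_div_mul_cancel (by positivity)
  have hlog : Real.log (1 + T) ≤ Real.log ((d : ℝ) * T * (1 + D)) :=
    Real.log_le_log (by positivity) (by linarith)
  have hlog0 : 0 ≤ Real.log (1 + T) := Real.log_nonneg (by linarith)
  have hsqrt : √(R * Q) = R * √(Q / R) := by
    rw [show R * Q = (R * √(Q / R)) ^ 2 by linear_combination (-R) * hσ2,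
      Real.sqrt_sq (by positivity)]
  rw [hsqrt]
  rw [← hQdef] at hrate
  have hS2 : (2 : ℝ) ≤ (2 : ℝ) ^ s := by
    calc (2 : ℝ) = (2 : ℝ) ^ (1 : ℤ) := (zpow_one _).symm
      _ ≤ _ := zpow_le_zpow_right₀ one_le_two hs'
  rw [div_le_iff₀ hJ, mul_comm] at hs1
  have hs3 : (2 : ℝ) ^ j * (2 : ℝ) ^ s ≤ 2 * √(Q / R) + 2 * (2 : ℝ) ^ j := by
    have h1 := mul_le_mul_of_nonneg_left hs2 hJ.le
    have h2 : (2 : ℝ) ^ j * (2 * (√(Q / R) / (2 : ℝ) ^ j) + (2 : ℝ) ^ (1 : ℤ))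
        = 2 * √(Q / R) + 2 * (2 : ℝ) ^ j := by
      rw [zpow_one]; field_simp
    linarith
  have hRJ : R * (2 : ℝ) ^ j ≤ 2 * (R * ‖u‖) + 1 := by
    have h1 := mul_le_mul_of_nonneg_left hju (by linarith : 0 ≤ R)
    have h2 : R * (2 : ℝ) ^ (-clog2 ((d : ℝ) * T)) ≤ 1 := by
      refine (mul_le_mul_of_nonneg_left hlow (by linarith)).trans ?_
      rw [mul_one_div, div_le_one hdT]; linarith
    linarith
  have hinv : ∀ x : ℝ, x / onsRate (j, s) = x * (64 * ((2 : ℝ) ^ j * (2 : ℝ) ^ s)) := by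
    intro x
    rw [div_eq_iff hηpos.ne', mul_assoc, mul_comm _ (onsRate _), hηW, mul_one]
  have hinv3 : ∀ x : ℝ, x / (3 * onsRate (j, s))
      = x * (64 * ((2 : ℝ) ^ j * (2 : ℝ) ^ s)) / 3 := by
    intro x; rw [mul_comm, ← div_div, hinv]
  rw [hinv] at hmain
  rw [hinv3] at hrate
  have hU := norm_nonneg u
  set η := onsRate (j, s)
  set J := (2 : ℝ) ^ j
  set S := (2 : ℝ) ^ s
  set σ := √(Q / R)
  set L := Real.log ((d : ℝ) * T * (1 + D))
  set W := J * S with hW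
  set r := ((errGram ℓ m T).rank : ℝ)
  set U := ‖u‖
  clear_value η J S σ L r U R Q
  have hW0 : 0 ≤ W := by rw [hW]; exact mul_nonneg hJ.le (by linarith)
  have hJW : J ≤ W := by rw [hW]; exact le_mul_of_one_le_right hJ.le (by linarith)
  clear_value W
  have hηU : η * U ^ 2 ≤ J / 64 := by
    have h1 := mul_le_mul_of_nonneg_left (pow_le_pow_left₀ hU huj 2) hηpos.le
    have h2 := mul_le_mul_of_nonneg_left hJW (mul_pos hηpos hJ).le
    have h3 : η * J * W = J / 64 := by linear_combination J / 64 * hηW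
    linarith
  have hηQ : η * Q ≤ R * σ / 64 := by
    have h1 : η * σ ≤ 1 / 64 := by
      have := mul_le_mul_of_nonneg_left hs1 hηpos.le
      linarith
    have h2 : 0 ≤ R * σ := by positivity
    have h3 := mul_le_mul_of_nonneg_left h1 h2
    have h4 : η * Q = R * σ * (η * σ) := by rw [← hσ2]; ring
    linarith
  have hrL : r * Real.log (1 + T) ≤ R * L := mul_le_mul hrR hlog hlog0 (by linarith)
  have hWL : r * Real.log (1 + T) * W ≤ R * L * W := mul_le_mul_of_nonneg_right hrL hW0
  have hLW : L * W ≤ R * L * W := by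
    have : 1 * (L * W) ≤ R * (L * W) := mul_le_mul_of_nonneg_right hR1 (by positivity)
    linarith
  have hRLW : R * L * W ≤ L * (2 * (R * σ) + 2 * (2 * (R * U) + 1)) := by
    have h1 : R * W ≤ 2 * (R * σ) + 2 * (R * J) := by
      have := mul_le_mul_of_nonneg_left hs3 (by linarith : 0 ≤ R)
      linarith
    have h2 := mul_le_mul_of_nonneg_left (h1.trans
      (by linarith : _ ≤ 2 * (R * σ) + 2 * (2 * (R * U) + 1))) (by linarith : 0 ≤ L)
    linarith
  have hJR : J ≤ R * J := le_mul_of_one_le_left hJ.le hR1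
  have hRσ : 0 ≤ R * σ := by positivity
  have hRU : 0 ≤ R * U := by positivity
  have e1 : 1 * (R * σ) ≤ L * (R * σ) := mul_le_mul_of_nonneg_right hL hRσ
  have e2 : 1 * (R * U) ≤ L * (R * U) := mul_le_mul_of_nonneg_right hL hRU
  linarith

/-- The bound of the gradient descent experts, for the scale `2 ^ j ≈ ‖u‖` and the learning rate
`η ≈ 1 / (2 ^ j √(∑ ‖ℓ - m‖²))`. -/
theorem regret_le_of_gdExpert {K : Set (Vec d)} (hc : IsCompact K) (hK : Convex ℝ K)
    (h0 : (0 : Vec d) ∈ K) {T : ℕ} {D : ℝ} (hKD : ∀ w ∈ K, ‖w‖ ≤ D) (hT : 2 ≤ T)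
    (hD : 1 ≤ (d : ℝ) * T * D) (hTD : 1 ≤ (T : ℝ) * D)
    {ℓ m : ℕ → Vec d} (hy : ∀ t < T, ‖ℓ t - m t‖ ≤ 1) {u : Vec d} (hu : u ∈ K) :
    regret (bestOfThree K T D ℓ m) ℓ T u
      ≤ 20000 * Real.log ((d : ℝ) * T * (1 + D)) *
        (1 + ‖u‖ + ‖u‖ * √(∑ t ∈ Finset.range T, ‖ℓ t - m t‖ ^ 2)) := by
  obtain ⟨hD0, hd, hT', hTd, hX1, hX2, hL⟩ := param_bounds hT hD
  have hT0 : 0 < (T : ℝ) := by linarith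
  obtain ⟨j, hj, huj, hju⟩ := exists_two_zpow_mem_Icc (neg_clog2_le_clog2 hT0 hD0 hTD)
    ((hKD u hu).trans (le_two_zpow_clog2 hD0)) (norm_nonneg u)
  have hlow := two_zpow_neg_clog2_le hT0
  have hV := sum_norm_sq_le hy
  have hV0 : 0 ≤ ∑ t ∈ Finset.range T, ‖ℓ t - m t‖ ^ 2 :=
    Finset.sum_nonneg fun t _ => sq_nonneg _
  set V := ∑ t ∈ Finset.range T, ‖ℓ t - m t‖ ^ 2 with hVdef
  have hJ : (0 : ℝ) < (2 : ℝ) ^ j := by positivity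
  have hv0 : 0 ≤ √V := Real.sqrt_nonneg _
  have hv2 : √V ^ 2 = V := Real.sq_sqrt hV0
  have hvT : √V ≤ T := by
    rw [Real.sqrt_le_iff]
    exact ⟨by positivity, by nlinarith⟩
  obtain ⟨s, hs, hs1, hs2⟩ := exists_two_zpow_mem_Icc (one_le_clog2 hT') (x := √V)
    (hvT.trans (le_two_zpow_clog2 hT0)) hv0
  rw [zpow_one] at hs2
  have hk : (j, s) ∈ gdIndex T D := Finset.mem_product.2 ⟨hj, hs⟩
  have hs' : 1 ≤ s := (Finset.mem_Icc.1 hs).1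
  have hmain := bestOfThree_regret_le hc hK h0 hT hD hy (.inr (.inl ⟨_, hk⟩)) u
  simp only [unionExpert, gdExpert] at hmain
  have hηpos : 0 < gdRate (j, s) := by unfold gdRate; positivity
  have hηW : gdRate (j, s) * (32 * ((2 : ℝ) ^ j * (2 : ℝ) ^ s)) = 1 := by
    rw [gdRate, ← zpow_add₀ two_ne_zero]
    exact one_div_mul_cancel (by positivity)
  have h4j : (4 : ℝ) ^ j = ((2 : ℝ) ^ j) ^ 2 := by
    rw [← zpow_natCast, ← zpow_mul, mul_comm, zpow_mul]; norm_num
  have hrate := optGD_regret_le (isCompact_cut hc j) (convex_cut hK j)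
    (by positivity : 0 < (4 : ℝ) ^ j * gdRate (j, s)) ℓ m (u := u) ⟨hu, huj⟩ T
  have hSw : ∑ t ∈ Finset.range T,
      inner ℝ (optGD (cut K j) ((4 : ℝ) ^ j * gdRate (j, s)) ℓ m t) (ℓ t - m t) ^ 2
      ≤ ((2 : ℝ) ^ j) ^ 2 * V := by
    rw [hVdef, Finset.mul_sum]
    refine Finset.sum_le_sum fun t _ => ?_
    have hmem := (optGD_mem (isCompact_cut hc j) ⟨0, zero_mem_cut h0 j⟩ (convex_cut hK j)
      (by positivity : 0 < (4 : ℝ) ^ j * gdRate (j, s)) ℓ m t).2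
    rw [← sq_abs, ← mul_pow]
    exact pow_le_pow_left₀ (abs_nonneg _) ((abs_real_inner_le_norm _ _).trans
      (mul_le_mul_of_nonneg_right hmem (norm_nonneg _))) 2
  rw [← hVdef] at hrate
  have hinv : ∀ x : ℝ, x / gdRate (j, s) = x * (32 * ((2 : ℝ) ^ j * (2 : ℝ) ^ s)) := by
    intro x
    rw [div_eq_iff hηpos.ne', mul_assoc, mul_comm _ (gdRate _), hηW, mul_one]
  have hu2 : ‖u‖ ^ 2 / (2 * ((4 : ℝ) ^ j * gdRate (j, s)))
      ≤ 16 * ((2 : ℝ) ^ j * (2 : ℝ) ^ s) := by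
    have h1 : ‖u‖ ^ 2 / (2 * ((4 : ℝ) ^ j * gdRate (j, s)))
        = ‖u‖ ^ 2 / ((2 : ℝ) ^ j) ^ 2 / gdRate (j, s) / 2 := by
      rw [h4j]; field_simp
    have h2 : ‖u‖ ^ 2 / ((2 : ℝ) ^ j) ^ 2 ≤ 1 := by
      rw [div_le_one (by positivity)]; exact pow_le_pow_left₀ (norm_nonneg _) huj 2
    rw [h1, hinv]
    have h3 := mul_le_mul_of_nonneg_right h2
      (by positivity : 0 ≤ 32 * ((2 : ℝ) ^ j * (2 : ℝ) ^ s))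
    linarith
  rw [hinv] at hmain
  rw [h4j] at hmain hrate hu2 hSw
  have hU := norm_nonneg u
  have hJlow : (2 : ℝ) ^ j ≤ 2 * ‖u‖ + 1 / T := hju.trans (by linarith)
  have hS0 : (0 : ℝ) ≤ (2 : ℝ) ^ s := by positivity
  set η := gdRate (j, s)
  set J := (2 : ℝ) ^ j
  set S := (2 : ℝ) ^ s
  set L := Real.log ((d : ℝ) * T * (1 + D))
  set v := √V
  set U := ‖u‖
  clear_value η J S L v U V
  have hηV : η * (J ^ 2 * V) ≤ J * v := by
    have h1 : η * J * S = 1 / 32 := by linear_combination 1 / 32 * hηW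
    have h2 := mul_le_mul_of_nonneg_left hs1 (mul_pos hηpos hJ).le
    have h3 := mul_le_mul_of_nonneg_left (h2.trans_eq h1) (mul_nonneg hJ.le hv0)
    have h4 : η * (J ^ 2 * V) = J * v * (η * J * v) := by rw [← hv2]; ring
    have h5 := mul_nonneg hJ.le hv0
    linarith
  have hηS := mul_le_mul_of_nonneg_left hSw hηpos.le
  have hJ1 : J ≤ 2 * U + 1 := by
    have : 1 / (T : ℝ) ≤ 1 := by rw [div_le_one hT0]; linarith
    linarith
  have hJv : J * v ≤ 2 * (U * v) + 1 := by
    have h1 := mul_le_mul_of_nonneg_right hJlow hv0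
    have h2 : 1 / (T : ℝ) * v ≤ 1 := by rw [one_div_mul_eq_div, div_le_one hT0]; exact hvT
    linarith
  have hW : J * S ≤ 2 * (J * v) + 2 * J := by
    have := mul_le_mul_of_nonneg_left hs2 hJ.le
    linarith
  have hLW := mul_le_mul_of_nonneg_left (hW.trans
    (by linarith : _ ≤ 2 * (2 * (U * v) + 1) + 2 * (2 * U + 1))) (by linarith : 0 ≤ L)
  have hUv : 0 ≤ U * v := by positivity
  have hW0 : 0 ≤ J * S := mul_nonneg hJ.le hS0
  have e0 : 1 * (J * S) ≤ L * (J * S) := mul_le_mul_of_nonneg_right hL hW0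
  have e1 : 1 * (U * v) ≤ L * (U * v) := mul_le_mul_of_nonneg_right hL hUv
  have e2 : 1 * U ≤ L * U := mul_le_mul_of_nonneg_right hL hU
  linarith

theorem quadForm_eq_zero_of_rank_eq_zero {A : Matrix (Fin d) (Fin d) ℝ} (hA : A.rank = 0)
    (u : Vec d) : quadForm A u = 0 := by
  have h1 : LinearMap.range A.mulVecLin = ⊥ := Submodule.finrank_eq_zero.1 hA
  have h2 : A.mulVec u.ofLp = 0 := by
    have h3 := LinearMap.range_eq_bot.1 h1
    exact LinearMap.congr_fun h3 u.ofLp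
  rw [quadForm, h2, dotProduct_zero]

theorem quadForm_matSqrt_one_add_errGram_le {ℓ m : ℕ → Vec d} {T : ℕ}
    (hy : ∀ t < T, ‖ℓ t - m t‖ ≤ 1) (u : Vec d) :
    quadForm (matSqrt (1 + errGram ℓ m T)) u ≤ (1 + T) * ‖u‖ ^ 2 := by
  have h := quadForm_matSqrt_le_mul (Matrix.PosSemidef.one.add (errGram_posSemidef ℓ m T))
    Matrix.PosSemidef.one (by positivity : (0 : ℝ) ≤ 1 + T) (fun v => by
      rw [quadForm_add, quadForm_one, quadForm_errGram]
      have h1 := sum_inner_sq_le hy v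
      have h2 : (0 : ℝ) ≤ T * ‖v‖ ^ 2 := by positivity
      have h3 : (0 : ℝ) ≤ (T : ℝ) ^ 2 * ‖v‖ ^ 2 := by positivity
      linarith) u
  rwa [matSqrt_one, quadForm_one] at h

/-- `uᵀ ℒ u ≤ (uᵀ (1 + ℒ)^{1/2} u) tr(ℒ^{1/2})`. -/
theorem sum_inner_sq_le_quadForm_mul_trace (ℓ m : ℕ → Vec d) (T : ℕ) (u : Vec d) :
    ∑ t ∈ Finset.range T, inner ℝ u (ℓ t - m t) ^ 2
      ≤ quadForm (matSqrt (1 + errGram ℓ m T)) u * (matSqrt (errGram ℓ m T)).trace := by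
  have hE := errGram_posSemidef ℓ m T
  have h1 := quadForm_mul_self_le_trace_mul (matSqrt_posSemidef (errGram ℓ m T)) u
  rw [matSqrt_mul_self hE, quadForm_errGram] at h1
  have h2 := quadForm_matSqrt_le_mul hE (Matrix.PosSemidef.one.add hE) zero_le_one (fun v => by
    rw [quadForm_add, quadForm_one]
    have := sq_nonneg ‖v‖
    linarith) u
  rw [one_mul] at h2
  refine h1.trans ?_
  rw [mul_comm]
  exact mul_le_mul_of_nonneg_right h2 (matSqrt_posSemidef _).trace_nonneg

theorem trace_matSqrt_errGram_le {ℓ m : ℕ → Vec d} {T : ℕ} (hy : ∀ t < T, ‖ℓ t - m t‖ ≤ 1) :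
    (matSqrt (errGram ℓ m T)).trace ≤ T := by
  have h1 := trace_matSqrt_le (errGram_posSemidef ℓ m T)
  have h2 : ((errGram ℓ m T).rank : ℝ) ≤ T := by exact_mod_cast rank_errGram_le ℓ m T
  have h3 := trace_errGram_eq ℓ m T
  have h4 := sum_norm_sq_le hy
  linarith

/-- The bound of the AdaGrad experts, for the scales `2 ^ j ≈ ‖u‖` and
`2 ^ l ≈ uᵀ (1 + ℒ)^{1/2} u`, and the learning rate `η ≈ 1 / √(2 ^ l tr(ℒ^{1/2}))`. -/
theorem regret_le_of_agExpert {K : Set (Vec d)} (hc : IsCompact K) (hK : Convex ℝ K)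
    (h0 : (0 : Vec d) ∈ K) {T : ℕ} {D : ℝ} (hKD : ∀ w ∈ K, ‖w‖ ≤ D) (hT : 2 ≤ T)
    (hD : 1 ≤ (d : ℝ) * T * D) (hTD : 1 ≤ (T : ℝ) * D)
    {ℓ m : ℕ → Vec d} (hy : ∀ t < T, ‖ℓ t - m t‖ ≤ 1) {u : Vec d} (hu : u ∈ K) :
    regret (bestOfThree K T D ℓ m) ℓ T u
      ≤ 20000 * Real.log ((d : ℝ) * T * (1 + D)) *
        (1 + ‖u‖ + √(quadForm (matSqrt (1 + errGram ℓ m T)) u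
          * (matSqrt (errGram ℓ m T)).trace)) := by
  obtain ⟨hD0, hd, hT', hTd, hX1, hX2, hL⟩ := param_bounds hT hD
  have hT0 : 0 < (T : ℝ) := by linarith
  obtain ⟨j, hj, huj, hju⟩ := exists_two_zpow_mem_Icc (neg_clog2_le_clog2 hT0 hD0 hTD)
    ((hKD u hu).trans (le_two_zpow_clog2 hD0)) (norm_nonneg u)
  have hlow := two_zpow_neg_clog2_le hT0
  have ha0 := quadForm_nonneg (matSqrt_posSemidef (1 + errGram ℓ m T)) u
  have haU := quadForm_matSqrt_one_add_errGram_le hy u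
  have hb0 := (matSqrt_posSemidef (errGram ℓ m T)).trace_nonneg
  have hbT := trace_matSqrt_errGram_le hy
  have hQab := sum_inner_sq_le_quadForm_mul_trace ℓ m T u
  have haD : quadForm (matSqrt (1 + errGram ℓ m T)) u ≤ 2 * D ^ 2 * T := by
    have h1 := pow_le_pow_left₀ (norm_nonneg u) (hKD u hu) 2
    have h2 : (1 + (T : ℝ)) * ‖u‖ ^ 2 ≤ (2 * T) * D ^ 2 :=
      mul_le_mul (by linarith) h1 (by positivity) (by positivity)
    linarith
  have hD2T : 0 < 2 * D ^ 2 * T := by positivity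
  obtain ⟨l, hl, hal, hla⟩ := exists_two_zpow_mem_Icc
    (neg_clog2_le_clog2 hT0 hD2T (by nlinarith)) (haD.trans (le_two_zpow_clog2 hD2T)) ha0
  set a := quadForm (matSqrt (1 + errGram ℓ m T)) u with ha
  set b := (matSqrt (errGram ℓ m T)).trace with hb
  set Q := ∑ t ∈ Finset.range T, inner ℝ u (ℓ t - m t) ^ 2 with hQdef
  have hJ : (0 : ℝ) < (2 : ℝ) ^ j := by positivity
  have hl0 : (0 : ℝ) < (2 : ℝ) ^ l := by positivity
  have hJT : 1 ≤ 2 * T * (2 : ℝ) ^ j := by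
    have h1 : (2 : ℝ) ^ (-clog2 (T : ℝ)) ≤ (2 : ℝ) ^ j :=
      zpow_le_zpow_right₀ one_le_two (Finset.mem_Icc.1 hj).1
    have h2 := two_zpow_clog2_le hT0
    have h3 : (2 : ℝ) ^ clog2 (T : ℝ) * (2 : ℝ) ^ (-clog2 (T : ℝ)) = 1 := by
      rw [← zpow_add₀ two_ne_zero]; simp
    have h4 : (0 : ℝ) < (2 : ℝ) ^ (-clog2 (T : ℝ)) := by positivity
    rw [← h3]
    exact mul_le_mul h2 h1 h4.le (by positivity)
  have hβ0 : 0 ≤ √((2 : ℝ) ^ l * b) := Real.sqrt_nonneg _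
  have hβ2 : √((2 : ℝ) ^ l * b) ^ 2 = (2 : ℝ) ^ l * b := Real.sq_sqrt (by positivity)
  -- If `a` is below the lowest `2 ^ l ≤ 1 / T`, then `2 ^ l b ≤ 1` because `b ≤ T`.
  have hlab : (2 : ℝ) ^ l * b ≤ 2 * (a * b) + 1 := by
    have h1 := mul_le_mul_of_nonneg_right hla hb0
    have h2 : (2 : ℝ) ^ (-clog2 (T : ℝ)) * b ≤ 1 := by
      refine (mul_le_mul_of_nonneg_right hlow hb0).trans ?_
      rw [one_div_mul_eq_div, div_le_one hT0]; exact hbT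
    linarith
  -- The factor `4` brings the ideal `2 ^ s` below `T`, hence below the top of its grid.
  have hβT : √((2 : ℝ) ^ l * b) ≤ T * (4 * (2 : ℝ) ^ j) := by
    rw [Real.sqrt_le_iff]
    refine ⟨by positivity, hlab.trans ?_⟩
    have h1 : a ≤ 2 * T * ((2 : ℝ) ^ j) ^ 2 := by
      refine haU.trans (mul_le_mul (by linarith) (pow_le_pow_left₀ (norm_nonneg _) huj 2)
        (by positivity) (by positivity))
    have h2 : a * b ≤ 2 * T * ((2 : ℝ) ^ j) ^ 2 * T := mul_le_mul h1 hbT hb0 (by positivity)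
    have h3 : (1 : ℝ) ≤ (2 * T * (2 : ℝ) ^ j) ^ 2 := one_le_pow₀ hJT
    have h4 : (0 : ℝ) ≤ (T : ℝ) ^ 2 * ((2 : ℝ) ^ j) ^ 2 := by positivity
    linarith
  obtain ⟨s, hs, hs1, hs2⟩ := exists_two_zpow_mem_Icc
    (one_le_clog2 (by linarith : 2 ≤ (d : ℝ) * T))
    (x := √((2 : ℝ) ^ l * b) / (4 * (2 : ℝ) ^ j))
    (((div_le_iff₀ (by positivity)).2 hβT).trans (hTd.trans (le_two_zpow_clog2 (by linarith))))
    (by positivity)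
  have hk : (j, s, l) ∈ agIndex d T D :=
    Finset.mem_product.2 ⟨hj, Finset.mem_product.2 ⟨hs, hl⟩⟩
  have hs' : 1 ≤ s := (Finset.mem_Icc.1 hs).1
  have hmain := bestOfThree_regret_le hc hK h0 hT hD hy (.inr (.inr ⟨_, hk⟩)) u
  simp only [unionExpert, agExpert] at hmain
  have hηpos : 0 < agRate (j, s, l) := by unfold agRate; positivity
  have hηW : agRate (j, s, l) * (64 * ((2 : ℝ) ^ j * (2 : ℝ) ^ s)) = 1 := by
    rw [agRate, ← zpow_add₀ two_ne_zero]
    exact one_div_mul_cancel (by positivity)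
  have hrate := adaGrad_regret_le (isCompact_cut hc j) (convex_cut hK j)
    (by positivity : 0 < (2 : ℝ) ^ (l + 1) * agRate (j, s, l))
    (by positivity : 0 < 2 * agRate (j, s, l)) (fun w hw => by
      have h1 := rate_mul_norm_le (by norm_num : (0 : ℝ) < 64) hs' hw.2
      change 32 * (2 * (1 / (64 * (2 : ℝ) ^ (j + s)))) * ‖w‖ ≤ 1 / 2
      linarith) ℓ m (u := u) ⟨hu, huj⟩ hy
  rw [← ha, ← hb, ← hQdef] at hrate
  have hinv : ∀ x : ℝ, x / agRate (j, s, l) = x * (64 * ((2 : ℝ) ^ j * (2 : ℝ) ^ s)) := by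
    intro x
    rw [div_eq_iff hηpos.ne', mul_assoc, mul_comm _ (agRate _), hηW, mul_one]
  have ha2 : a / ((2 : ℝ) ^ (l + 1) * agRate (j, s, l)) ≤ 32 * ((2 : ℝ) ^ j * (2 : ℝ) ^ s) := by
    have h1 : a / (2 : ℝ) ^ (l + 1) ≤ 1 / 2 := by
      rw [zpow_add_one₀ two_ne_zero, div_le_iff₀ (by positivity)]; linarith
    rw [← div_div, hinv]
    have h3 := mul_le_mul_of_nonneg_right h1
      (by positivity : 0 ≤ 64 * ((2 : ℝ) ^ j * (2 : ℝ) ^ s))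
    linarith
  rw [hinv] at hmain
  rw [zpow_add_one₀ two_ne_zero] at hmain hrate ha2
  have hU := norm_nonneg u
  rw [div_le_iff₀ (by positivity)] at hs1
  have hs3 : (2 : ℝ) ^ j * (2 : ℝ) ^ s ≤ √((2 : ℝ) ^ l * b) / 2 + 2 * (2 : ℝ) ^ j := by
    have h1 := mul_le_mul_of_nonneg_left hs2 hJ.le
    have h2 : (2 : ℝ) ^ j * (2 * (√((2 : ℝ) ^ l * b) / (4 * (2 : ℝ) ^ j)) + (2 : ℝ) ^ (1 : ℤ))
        = √((2 : ℝ) ^ l * b) / 2 + 2 * (2 : ℝ) ^ j := by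
      rw [zpow_one]; field_simp; ring
    linarith
  have hβab : √((2 : ℝ) ^ l * b) ≤ 2 * √(a * b) + 1 := by
    rw [Real.sqrt_le_iff]
    have h1 : √(a * b) ^ 2 = a * b := Real.sq_sqrt (by positivity)
    have h2 : 0 ≤ √(a * b) := Real.sqrt_nonneg _
    exact ⟨by positivity, by nlinarith⟩
  have hab0 : 0 ≤ √(a * b) := Real.sqrt_nonneg _
  have hJ1 : (2 : ℝ) ^ j ≤ 2 * ‖u‖ + 1 := by
    have : 1 / (T : ℝ) ≤ 1 := by rw [div_le_one hT0]; linarith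
    linarith
  have hQ2 : Q ≤ (2 : ℝ) ^ l * b := hQab.trans (mul_le_mul_of_nonneg_right hal hb0)
  have hS0 : (0 : ℝ) ≤ (2 : ℝ) ^ s := by positivity
  set η := agRate (j, s, l)
  set J := (2 : ℝ) ^ j
  set S := (2 : ℝ) ^ s
  set Λ := (2 : ℝ) ^ l
  set L := Real.log ((d : ℝ) * T * (1 + D))
  set β := √(Λ * b)
  set γ := √(a * b)
  set U := ‖u‖
  clear_value η J S Λ L β γ U a b Q
  have hηβ : η * (Λ * b) ≤ β / 16 := by
    have h1 := mul_le_mul_of_nonneg_left hs1 (mul_nonneg hηpos.le hβ0)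
    have h2 : η * β * (S * (4 * J)) = β / 16 := by linear_combination β / 16 * hηW
    have h3 : η * (Λ * b) = η * β * β := by rw [← hβ2]; ring
    linarith
  have hηQ := mul_le_mul_of_nonneg_left hQ2 hηpos.le
  have hLW := mul_le_mul_of_nonneg_left (hs3.trans
    (by linarith : _ ≤ (2 * γ + 1) / 2 + 2 * (2 * U + 1))) (by linarith : 0 ≤ L)
  have hW0 : 0 ≤ J * S := mul_nonneg hJ.le hS0
  have e0 : 1 * (J * S) ≤ L * (J * S) := mul_le_mul_of_nonneg_right hL hW0
  have e1 : 1 * γ ≤ L * γ := mul_le_mul_of_nonneg_right hL hab0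
  have e2 : 0 ≤ L * U := mul_nonneg (by linarith) hU
  linarith

end Tuning

end BestOfThree

end

theorem mainTheorem7 :
    ∃ C : ℝ, 0 < C ∧
      ∀ (d T : ℕ) (D : ℝ) (K : Set (BestOfThree.Vec d)),
        2 ≤ T → IsCompact K → Convex ℝ K → (0 : BestOfThree.Vec d) ∈ K →
        (∀ w ∈ K, ‖w‖ ≤ D) → 1 ≤ (d : ℝ) * T * D →
        ∀ ℓ m : ℕ → BestOfThree.Vec d, (∀ t < T, ‖ℓ t - m t‖ ≤ 1) →
          (∀ t < T, BestOfThree.bestOfThree K T D ℓ m t ∈ K) ∧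
          ∀ u ∈ K,
            BestOfThree.regret (BestOfThree.bestOfThree K T D ℓ m) ℓ T u ≤
              C * Real.log ((d : ℝ) * T * (1 + D)) *
                (1 + max ((BestOfThree.errGram ℓ m T).rank : ℝ) 1 * ‖u‖
                  + √(((BestOfThree.errGram ℓ m T).rank : ℝ)
                      * ∑ t ∈ Finset.range T, (inner ℝ u (ℓ t - m t)) ^ 2)) ∧
            BestOfThree.regret (BestOfThree.bestOfThree K T D ℓ m) ℓ T u ≤
              C * Real.log ((d : ℝ) * T * (1 + D)) *
                (1 + ‖u‖ + ‖u‖ * √(∑ t ∈ Finset.range T, ‖ℓ t - m t‖ ^ 2)) ∧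
            BestOfThree.regret (BestOfThree.bestOfThree K T D ℓ m) ℓ T u ≤
              C * Real.log ((d : ℝ) * T * (1 + D)) *
                (1 + ‖u‖
                  + √(BestOfThree.quadForm
                        (BestOfThree.matSqrt (1 + BestOfThree.errGram ℓ m T)) u
                      * (BestOfThree.matSqrt (BestOfThree.errGram ℓ m T)).trace)) := by
  open BestOfThree in
  refine ⟨60000, by norm_num, ?_⟩
  intro d T D K hT hc hK h0 hKD hD ℓ m hy
  obtain ⟨hD0, hd, hT', hTd, hX1, hX2, hL⟩ := param_bounds hT hD
  refine ⟨fun t _ => ?_, fun u hu => ?_⟩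
  · have hmem : (-clog2 ((d : ℝ) * T), (1 : ℤ)) ∈ onsIndex d T D := by
      simp only [onsIndex, Finset.mem_product, Finset.mem_Icc]
      exact ⟨⟨le_rfl, neg_clog2_le_clog2 (by linarith) hD0 hD⟩, le_rfl, one_le_clog2 hT'⟩
    have : Nonempty (UnionIndex d T D) := ⟨.inl ⟨_, hmem⟩⟩
    exact master_mem (unionExpert_rate_pos K T D) hK
      fun k => (unionExpert_mem hc hK h0 ℓ m t k).1
  have hons := regret_le_of_onsExpert hc hK h0 hKD hT hD hy hu
  have hgd := fun hTD => regret_le_of_gdExpert hc hK h0 hKD hT hD hTD hy hu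
  have hag := fun hTD => regret_le_of_agExpert hc hK h0 hKD hT hD hTD hy hu
  set L := Real.log ((d : ℝ) * T * (1 + D))
  clear_value L
  have hup : ∀ {x y : ℝ}, 0 ≤ y → x ≤ 20000 * L * y → x ≤ 60000 * L * y := by
    intro x y hy0 hxy
    have : 0 ≤ L * y := mul_nonneg (by linarith) hy0
    linarith
  have hU := norm_nonneg u
  have hR0 : 0 ≤ max ((errGram ℓ m T).rank : ℝ) 1 := le_max_of_le_right zero_le_one
  have hs0 := fun x => Real.sqrt_nonneg x
  have hn1 := mul_nonneg hR0 hU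
  have hn2 := mul_nonneg hU (hs0 (∑ t ∈ Finset.range T, ‖ℓ t - m t‖ ^ 2))
  refine ⟨?_, ?_⟩
  · have heq : √(max ((errGram ℓ m T).rank : ℝ) 1
          * ∑ t ∈ Finset.range T, inner ℝ u (ℓ t - m t) ^ 2)
        = √(((errGram ℓ m T).rank : ℝ)
          * ∑ t ∈ Finset.range T, inner ℝ u (ℓ t - m t) ^ 2) := by
      rcases Nat.eq_zero_or_pos (errGram ℓ m T).rank with hr | hr
      · -- A Gram matrix of rank zero vanishes, so both sides are zero.
        rw [← quadForm_errGram, quadForm_eq_zero_of_rank_eq_zero hr, mul_zero, mul_zero]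
      · rw [max_eq_left (by exact_mod_cast hr)]
    rw [heq] at hons
    exact hup (add_nonneg (add_nonneg zero_le_one hn1) (hs0 _)) hons
  rcases le_or_gt 1 ((T : ℝ) * D) with hTD | hTD
  · exact ⟨hup (add_nonneg (add_nonneg zero_le_one hU) hn2) (hgd hTD),
      hup (add_nonneg (add_nonneg zero_le_one hU) (hs0 _)) (hag hTD)⟩
  · -- For `D < 1 / T` the other two families may be empty, but then the first bound is `O(L)`.
    have hR : max ((errGram ℓ m T).rank : ℝ) 1 ≤ T :=
      max_le (by exact_mod_cast rank_errGram_le ℓ m T) (by linarith)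
    have hTu : (T : ℝ) * ‖u‖ ≤ 1 :=
      (mul_le_mul_of_nonneg_left (hKD u hu) (by linarith)).trans hTD.le
    have hRu := mul_le_mul_of_nonneg_right hR hU
    have hsq : √(max ((errGram ℓ m T).rank : ℝ) 1
        * ∑ t ∈ Finset.range T, inner ℝ u (ℓ t - m t) ^ 2) ≤ 1 := by
      rw [Real.sqrt_le_iff, one_pow]
      refine ⟨zero_le_one, ?_⟩
      refine (mul_le_mul hR (sum_inner_sq_le hy u)
        (Finset.sum_nonneg fun t _ => sq_nonneg _) (by linarith)).trans ?_
      rw [show (T : ℝ) * (T * ‖u‖ ^ 2) = (T * ‖u‖) ^ 2 by ring]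
      exact pow_le_one₀ (by positivity) hTu
    have hconst : regret (bestOfThree K T D ℓ m) ℓ T u ≤ 60000 * L := by
      refine hons.trans ?_
      have h20 : (0 : ℝ) ≤ 20000 * L := by linarith
      have := mul_le_mul_of_nonneg_left (by linarith :
        1 + max ((errGram ℓ m T).rank : ℝ) 1 * ‖u‖ + √(max ((errGram ℓ m T).rank : ℝ) 1
          * ∑ t ∈ Finset.range T, inner ℝ u (ℓ t - m t) ^ 2) ≤ 3) h20
      linarith
    have h60 : (0 : ℝ) ≤ 60000 * L := by linarith
    refine ⟨hconst.trans (le_mul_of_one_le_right h60 ?_),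
      hconst.trans (le_mul_of_one_le_right h60 ?_)⟩
    · linarith
    · linarith [hs0 (quadForm (matSqrt (1 + errGram ℓ m T)) u
        * (matSqrt (errGram ℓ m T)).trace)]
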